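/- Notation. For an open set $\Omega\subset\mathbb R^m$, $H^1_0(\Omega)$ is the closure of $C_c^\infty(\Omega)$ in the Sobolev space $H^1(\Omega)$, and the Dirichlet Laplacian of $\Omega$ is the self-adjoint operator in $L_2(\Omega)$ associated with the form $(\nabla u,\nabla v)_\Omega$ on $H^1_0(\Omega)$. Its spectrum is denoted by $\sigma(\Omega)$, and $\lambda_\bullet(\Omega)=\inf\sigma(\Omega)$. A bound state of $\Omega$ is an eigenfunction of the Dirichlet Laplacian for the eigenvalue $\lambda_\bullet(\Omega)$, i.e. a function $U\in H^1_0(\Omega)$, $U\neq0$, with $(\nabla U,\nabla v)_\Omega=\lambda_\bullet(\Omega)\,(U,v)_\Omega$ for all $v\in H^1_0(\Omega)$. The ($H^1$-)capacity of a compact set $K\subset\mathbb R^m$ is $$\operatorname{cap}(K)=\inf\Big\{\int_{\mathbb R^m}\big(\varphi^2+|\nabla\varphi|^2\big)\,dx:\ \varphi\in C_c^\infty(\mathbb R^m),\ \varphi\ge1\ \text{on}\ K\Big\}.$$ Theorem 4.4. Let $Q\subset\mathbb R^{n-1}$ be an open set, not necessarily bounded, and let $\mathcal O\subset\mathbb R^n$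 be a domain (a non-empty connected open set), whose cross-sections $\mathcal O\cap\{x_n=a\}$ may be unbounded too. Suppose that 1. $\mathcal O$ strictly contains the cylinder $Q\times\mathbb R$, and the difference is not negligible for $H^1$-functions: $\mathcal O\setminus(Q\times\mathbb R)$ contains a compact set of positive capacity (this holds, for instance, if $\mathcal O\setminus(Q\times\mathbb R)$ has positive Lebesgue measure; in particular, it follows from the strict inclusion if $Q$ has a Lipschitz boundary); 2. for some $R\in\mathbb R$, $\ \mathcal O\cap\{x:|x_n|>R\}=Q\times\{|x_n|>R\}$; 3. there is a bound state $U_\bullet(Q)$ of $Q$. Then $\sigma(Q)$ and $\sigma(\mathcal O)$ are non-empty and bounded below, and $\lambda_\bullet(\mathcal O)<\lambda_\bullet(Q)$. -/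

import Mathlib

open MeasureTheory Set
open scoped ContDiff

noncomputable section

/-- `φ ∈ C_c^∞(O)`, as a function on the whole space that is supported in `O`. -/
structure IsTestFunction {n : ℕ} (O : Set (EuclideanSpace ℝ (Fin n)))
    (φ : EuclideanSpace ℝ (Fin n) → ℝ) : Prop where
  contDiff : ContDiff ℝ ∞ φ
  hasCompactSupport : HasCompactSupport φ
  tsupport_subset : tsupport φ ⊆ O

/-- The real Hilbert space `L²(O)`. -/
abbrev L2 {n : ℕ} (O : Set (EuclideanSpace ℝ (Fin n))) : Type :=
  Lp ℝ 2 (volume.restrict O)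

/-- The real Hilbert space `L²(O; ℝⁿ)` of square-integrable vector fields. -/
abbrev L2Field {n : ℕ} (O : Set (EuclideanSpace ℝ (Fin n))) : Type :=
  Lp (EuclideanSpace ℝ (Fin n)) 2 (volume.restrict O)

/-- The pairs `(φ, ∇φ)`, `φ ∈ C_c^∞(O)`, in the Hilbert space `L²(O) × L²(O; ℝⁿ)`. -/
def testPairs {n : ℕ} (O : Set (EuclideanSpace ℝ (Fin n))) :
    Submodule ℝ (WithLp 2 (L2 O × L2Field O)) where
  carrier := {w | ∃ φ : EuclideanSpace ℝ (Fin n) → ℝ, IsTestFunction O φ ∧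
    w.fst =ᵐ[volume.restrict O] φ ∧ w.snd =ᵐ[volume.restrict O] gradient φ}
  add_mem' := by
    rintro v w ⟨φ, hφ, hv₁, hv₂⟩ ⟨ψ, hψ, hw₁, hw₂⟩
    refine ⟨φ + ψ, ⟨hφ.contDiff.add hψ.contDiff, hφ.hasCompactSupport.add hψ.hasCompactSupport,
      (tsupport_add φ ψ).trans (union_subset hφ.tsupport_subset hψ.tsupport_subset)⟩, ?_, ?_⟩
    · filter_upwards [Lp.coeFn_add v.fst w.fst, hv₁, hw₁] with x h h₁ h₂
      change (v.fst + w.fst : L2 O) x = _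
      rw [h, Pi.add_apply, Pi.add_apply, h₁, h₂]
    · filter_upwards [Lp.coeFn_add v.snd w.snd, hv₂, hw₂] with x h h₁ h₂
      have d₁ := (hφ.contDiff.differentiable (by simp)) x
      have d₂ := (hψ.contDiff.differentiable (by simp)) x
      have : gradient (φ + ψ) x = gradient φ x + gradient ψ x := by
        simp [gradient, fderiv_add d₁ d₂]
      change (v.snd + w.snd : L2Field O) x = _
      rw [h, Pi.add_apply, this, h₁, h₂]
  zero_mem' := by
    refine ⟨0, ⟨contDiff_const, HasCompactSupport.zero, by simp⟩, ?_, ?_⟩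
    · exact Lp.coeFn_zero _ _ _
    · filter_upwards [Lp.coeFn_zero (EuclideanSpace ℝ (Fin n)) 2 (volume.restrict O)] with x h
      change (0 : L2Field O) x = _
      rw [h]
      simp [gradient]
  smul_mem' := by
    rintro c w ⟨φ, hφ, hw₁, hw₂⟩
    refine ⟨c • φ, ⟨hφ.contDiff.const_smul c, hφ.hasCompactSupport.smul_left (f := fun _ => c),
      (closure_mono (Function.support_const_smul_subset c φ)).trans hφ.tsupport_subset⟩, ?_, ?_⟩
    · filter_upwards [Lp.coeFn_smul c w.fst, hw₁] with x h h₁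
      simp [h, h₁]
    · filter_upwards [Lp.coeFn_smul c w.snd, hw₂] with x h h₁
      have d₁ := (hφ.contDiff.differentiable (by simp)) x
      have : gradient (c • φ) x = c • gradient φ x := by
        simp [gradient, fderiv_const_smul d₁]
      simp [h, h₁, this]

/-- `H¹₀(O)`, the closure of `C_c^∞(O)` in the Sobolev norm. A function `u ∈ H¹₀(O)` is
represented by the pair `(u, ∇u)` in `L²(O) × L²(O; ℝⁿ)`: the second component of an element
is the weak gradient of the first one, and the norm is the `H¹`-norm. -/
def H10 {n : ℕ} (O : Set (EuclideanSpace ℝ (Fin n))) :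
    Submodule ℝ (WithLp 2 (L2 O × L2Field O)) :=
  (testPairs O).topologicalClosure

/-- The graph of the Dirichlet Laplacian of `O`, the self-adjoint operator in `L²(O)` associated
with the form `(∇u, ∇v)` on `H¹₀(O)`: `u` is in the domain and is mapped to `f` if and only if
`u ∈ H¹₀(O)` and `(∇u, ∇v) = (f, v)` for all `v ∈ H¹₀(O)`. -/
def IsDirichletLaplacian {n : ℕ} (O : Set (EuclideanSpace ℝ (Fin n))) (u f : L2 O) : Prop :=
  ∃ w ∈ H10 O, w.fst = u ∧ ∀ v ∈ H10 O, inner ℝ w.snd v.snd = inner ℝ f v.fst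

/-- The resolvent set of the Dirichlet Laplacian `A`: the `μ` for which `A - μ` is a bijection of
the domain of `A` onto `L²(O)` with a bounded inverse `T`. -/
def dirichletResolventSet {n : ℕ} (O : Set (EuclideanSpace ℝ (Fin n))) : Set ℝ :=
  {μ | ∃ T : L2 O →L[ℝ] L2 O, ∀ u f : L2 O, IsDirichletLaplacian O u (μ • u + f) ↔ u = T f}

/-- The spectrum of the Dirichlet Laplacian of `O`. -/
def dirichletSpectrum {n : ℕ} (O : Set (EuclideanSpace ℝ (Fin n))) : Set ℝ :=
  (dirichletResolventSet O)ᶜ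

/-- The lower bound of the spectrum of the Dirichlet Laplacian of `O`. -/
def spectralBottom {n : ℕ} (O : Set (EuclideanSpace ℝ (Fin n))) : ℝ :=
  sInf (dirichletSpectrum O)

/-- `U` is a bound state of `O`: an eigenfunction of the Dirichlet Laplacian for the eigenvalue
at the bottom of the spectrum. -/
def IsBoundState {n : ℕ} (O : Set (EuclideanSpace ℝ (Fin n))) (U : L2 O) : Prop :=
  U ≠ 0 ∧ IsDirichletLaplacian O U (spectralBottom O • U)

/-- The cylinder `Q × ℝ` in `ℝ^(d+1)`; its axis is the last coordinate axis. -/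
def cylinderOver {d : ℕ} (Q : Set (EuclideanSpace ℝ (Fin d))) :
    Set (EuclideanSpace ℝ (Fin (d + 1))) :=
  {x | WithLp.toLp 2 (fun i : Fin d => x i.castSucc) ∈ Q}

/-- The (Sobolev, `H¹`-) capacity of a compact set `K`. -/
def sobolevCapacity {n : ℕ} (K : Set (EuclideanSpace ℝ (Fin n))) : ℝ :=
  sInf {c | ∃ φ : EuclideanSpace ℝ (Fin n) → ℝ, IsTestFunction univ φ ∧ (∀ x ∈ K, 1 ≤ φ x) ∧
    c = ∫ x, (φ x ^ 2 + ‖gradient φ x‖ ^ 2)}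

end

/-!
The bottom of the spectrum of a Dirichlet Laplacian is the infimum of the Rayleigh quotient on
`H¹₀` (`isLeast_dirichletSpectrum`): below it the Lax–Milgram theorem gives the resolvent, and at
it a bounded inverse would contradict the existence of minimizing sequences. Hence, with
`c = λ(Q)`, failure of the strict inequality means that the shifted energy
`E(φ) = ‖∇φ‖² - c ‖φ‖²` is non-negative on `C_c^∞(O)`, and it has to be shown that every compact
`K ⊆ O \ (Q × ℝ)` then has capacity zero
(`sobolevCapacity_nonpos_of_shiftedEnergy_nonneg`).

The modulus `u = |U|` of the bound state, times a long cut-off in the axial direction, gives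
functions `w ≥ 0` in `C_c^∞(Q × ℝ)` with `E(w) → 0`, which are thus almost minimizers of `E` on all
of `O`. If the limit `u ⊗ 1` were known to be a smooth solution of `-Δu = c u ≥ 0` in `O`, the
strong maximum principle would make it positive in `O`, whereas it vanishes outside the cylinder.
The argument below is a capacitary form of this that needs no regularity theory. Testing the almost
minimality of `w` with the competitor `w + t η² / (w + ε)` bounds `∫ η² |∇ log (w + ε)|²` for each
cut-off `η` on `O`, uniformly in `w` and `ε` with `E(w) ≤ ε²`
(`IsTestFunction.integral_log_gradient_le`).
Therefore the functions `h = log (1 + w / ε) / log (1 / ε)`, which are test functions on the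
cylinder, satisfy `∇h → 0` in `L²_loc(O)` and `h → 1_{u > 0}` in `L²_loc` as `ε → 0`
(`exists_log_sequence`). So `1_{u > 0}` has zero weak gradient in the connected set `O` and is
constant there (`ae_eq_const_of_isPreconnected`); the constant is `1` because `u ≠ 0`. Finally
`η (1 - h)`, where `η = 1` on `K`, is equal to `1` on `K`, since `h` vanishes off the cylinder, and
tends to `0` in `H¹`, so that `K` has capacity zero (`sobolevCapacity_nonpos`).
-/

/-! ### The bottom of the spectrum -/

/-- The infimum of the Rayleigh quotient `‖∇v‖² / ‖v‖²` over the `v ∈ H¹₀(O)`, `v ≠ 0`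
(and `0` if there are none). -/
noncomputable def rayleighBottom {n : ℕ} (O : Set (EuclideanSpace ℝ (Fin n))) : ℝ :=
  sInf {c | ∃ v ∈ H10 O, v.fst ≠ 0 ∧ c = ‖v.snd‖ ^ 2 / ‖v.fst‖ ^ 2}

lemma bddBelow_rayleigh {n : ℕ} (O : Set (EuclideanSpace ℝ (Fin n))) :
    BddBelow {c | ∃ v ∈ H10 O, v.fst ≠ 0 ∧ c = ‖v.snd‖ ^ 2 / ‖v.fst‖ ^ 2} :=
  ⟨0, by rintro _ ⟨v, -, -, rfl⟩; positivity⟩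

lemma rayleighBottom_nonneg {n : ℕ} (O : Set (EuclideanSpace ℝ (Fin n))) :
    0 ≤ rayleighBottom O :=
  Real.sInf_nonneg (by rintro _ ⟨v, -, -, rfl⟩; positivity)

lemma rayleighBottom_mul_le {n : ℕ} {O : Set (EuclideanSpace ℝ (Fin n))}
    {v : WithLp 2 (L2 O × L2Field O)} (hv : v ∈ H10 O) :
    rayleighBottom O * ‖v.fst‖ ^ 2 ≤ ‖v.snd‖ ^ 2 := by
  by_cases h : v.fst = 0
  · simp [h]
  · have h' : 0 < ‖v.fst‖ ^ 2 := by positivity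
    exact (le_div_iff₀ h').1 (csInf_le (bddBelow_rayleigh O) ⟨v, hv, h, rfl⟩)

lemma sq_norm_eq_add {n : ℕ} {O : Set (EuclideanSpace ℝ (Fin n))}
    (v : WithLp 2 (L2 O × L2Field O)) : ‖v‖ * ‖v‖ = ‖v.fst‖ ^ 2 + ‖v.snd‖ ^ 2 := by
  rw [← sq, WithLp.prod_norm_sq_eq_of_L2]

/-- Below the Rayleigh quotients the form `(∇w, ∇v) - μ (w, v)` is coercive on `H¹₀(O)`, and the
Lax–Milgram theorem gives the resolvent. -/
theorem mem_dirichletResolventSet_of_lt_rayleighBottom {n : ℕ}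
    {O : Set (EuclideanSpace ℝ (Fin n))} {μ : ℝ} (hμ : μ < rayleighBottom O) :
    μ ∈ dirichletResolventSet O := by
  have : CompleteSpace (H10 O) :=
    (Submodule.isClosed_topologicalClosure (testPairs O)).completeSpace_coe
  obtain ⟨F, hF⟩ : ∃ F : H10 O →L[ℝ] L2 O, ∀ v, F v = v.1.fst :=
    ⟨(WithLp.fstL 2 ℝ (L2 O) (L2Field O)).comp (H10 O).subtypeL, fun _ => rfl⟩
  obtain ⟨G, hG⟩ : ∃ G : H10 O →L[ℝ] L2Field O, ∀ v, G v = v.1.snd :=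
    ⟨(WithLp.sndL 2 ℝ (L2 O) (L2Field O)).comp (H10 O).subtypeL, fun _ => rfl⟩
  obtain ⟨B, hB⟩ : ∃ B : H10 O →L[ℝ] H10 O →L[ℝ] ℝ,
      ∀ v w, B v w = inner ℝ (G v) (G w) - μ * inner ℝ (F v) (F w) :=
    ⟨(innerSL ℝ).bilinearComp G G - μ • (innerSL ℝ).bilinearComp F F, by simp⟩
  have coercive : IsCoercive B := by
    have h0 := rayleighBottom_nonneg O
    set c := rayleighBottom O
    have hden : 0 < 1 + c + |μ| := by positivity
    refine ⟨(c - μ) / (1 + c + |μ|), by apply div_pos <;> linarith, fun u => ?_⟩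
    have h1 := rayleighBottom_mul_le u.2
    have hn : ‖u‖ * ‖u‖ = ‖F u‖ ^ 2 + ‖G u‖ ^ 2 := by
      rw [hF, hG]; exact sq_norm_eq_add u.1
    rw [mul_assoc, hn, hB, real_inner_self_eq_norm_sq, real_inner_self_eq_norm_sq,
      div_mul_eq_mul_div, div_le_iff₀ hden]
    rw [← hF, ← hG] at h1
    -- the sum of the two products below is the difference of the two sides
    have e1 : 0 ≤ (1 + |μ| + μ) * (‖G u‖ ^ 2 - c * ‖F u‖ ^ 2) :=
      mul_nonneg (by linarith [neg_abs_le μ]) (by linarith)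
    have e2 : 0 ≤ (c - μ) * (|μ| * ‖F u‖ ^ 2) :=
      mul_nonneg (by linarith) (by positivity)
    linarith
  obtain ⟨E, hE⟩ : ∃ E : H10 O ≃L[ℝ] H10 O, ∀ v w, inner ℝ (E v) w = B v w :=
    ⟨coercive.continuousLinearEquivOfBilin, coercive.continuousLinearEquivOfBilin_apply⟩
  refine ⟨F.comp ((E.symm : H10 O →L[ℝ] H10 O).comp F.adjoint), fun u f => ?_⟩
  constructor
  · rintro ⟨w, hw, rfl, h⟩
    have key : E ⟨w, hw⟩ = F.adjoint f := by
      refine ext_inner_right ℝ fun v => ?_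
      rw [hE, hB,
        ContinuousLinearMap.adjoint_inner_left, hG, hG, hF, hF, h v v.2, inner_add_left,
        real_inner_smul_left]
      ring
    change w.fst = F (E.symm (F.adjoint f))
    rw [← key, E.symm_apply_apply, hF]
  · intro hu
    obtain ⟨g, hg⟩ : ∃ g, g = E.symm (F.adjoint f) := ⟨_, rfl⟩
    have hEg : E g = F.adjoint f := by rw [hg, E.apply_symm_apply]
    have hug : u = F g := by rw [hg]; exact hu
    refine ⟨g.1, g.2, (hug.trans (hF g)).symm, fun v hv => ?_⟩
    have key : inner ℝ (F.adjoint f) (⟨v, hv⟩ : H10 O) = B g ⟨v, hv⟩ := by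
      rw [← hEg, hE]
    rw [ContinuousLinearMap.adjoint_inner_left, hB, hF, hF, hG, hG] at key
    rw [inner_add_left, real_inner_smul_left, hug, hF]
    linarith

/-- The infimum of the Rayleigh quotients is in the spectrum: if `A - λ` had a bounded inverse
`T`, the Cauchy–Schwarz inequality for the non-negative form `q(w, v) = (∇w, ∇v) - λ (w, v)`,
applied to `T u` and `u`, would give `‖u‖⁴ ≤ ‖T‖ ‖u‖² q(u, u)`, which fails for minimizing `u`. -/
theorem rayleighBottom_mem_dirichletSpectrum {n : ℕ} {O : Set (EuclideanSpace ℝ (Fin n))}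
    (hne : ∃ v ∈ H10 O, v.fst ≠ 0) : rayleighBottom O ∈ dirichletSpectrum O := by
  rintro ⟨T, hT⟩
  set c := rayleighBottom O with hc
  have key : ∀ v ∈ H10 O, v.fst ≠ 0 → ‖v.fst‖ ^ 2 ≤ ‖T‖ * (‖v.snd‖ ^ 2 - c * ‖v.fst‖ ^ 2) := by
    intro v hv hv0
    obtain ⟨w, hw, hwT, h⟩ := (hT (T v.fst) v.fst).2 rfl
    have hwv := h v hv
    have hww := h w hw
    rw [inner_add_left, real_inner_smul_left, real_inner_self_eq_norm_sq] at hwv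
    rw [inner_add_left, real_inner_smul_left, real_inner_self_eq_norm_sq, ← hwT,
      real_inner_self_eq_norm_sq] at hww
    rw [← hwT] at hwv
    have hTv : inner ℝ v.fst w.fst ≤ ‖T‖ * ‖v.fst‖ ^ 2 := by
      refine (real_inner_le_norm _ _).trans ?_
      rw [hwT]
      nlinarith [T.le_opNorm v.fst, norm_nonneg v.fst]
    have hpos : 0 < ‖v.fst‖ ^ 2 := by positivity
    set Q := ‖v.snd‖ ^ 2 - c * ‖v.fst‖ ^ 2
    have hquad : ∀ t : ℝ, 0 ≤ t * t * (‖T‖ * ‖v.fst‖ ^ 2) + 2 * t * ‖v.fst‖ ^ 2 + Q := by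
      intro t
      have := rayleighBottom_mul_le ((H10 O).add_mem ((H10 O).smul_mem t hw) hv)
      simp only [WithLp.add_fst, WithLp.add_snd, WithLp.smul_fst, WithLp.smul_snd] at this
      rw [@norm_add_sq_real, @norm_add_sq_real, norm_smul, norm_smul, mul_pow, mul_pow,
        real_inner_smul_left, real_inner_smul_left, Real.norm_eq_abs, sq_abs] at this
      have : 0 ≤ t * t * inner ℝ v.fst w.fst + 2 * t * ‖v.fst‖ ^ 2 + Q := by
        rw [hwv, hww, ← hc] at this
        simp only [Q]
        linarith
      nlinarith [mul_self_nonneg t]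
    have hdisc := discrim_le_zero (a := ‖T‖ * ‖v.fst‖ ^ 2) (b := 2 * ‖v.fst‖ ^ 2) (c := Q)
      (fun t => by have := hquad t; linarith)
    rw [discrim] at hdisc
    -- divide the discriminant inequality by `4 ‖v.fst‖²`
    have : ‖v.fst‖ ^ 2 * ‖v.fst‖ ^ 2 ≤ ‖v.fst‖ ^ 2 * (‖T‖ * Q) := by nlinarith
    exact le_of_mul_le_mul_left this hpos
  obtain ⟨v₀, hv₀, hv₀'⟩ := hne
  have hTpos : 0 < ‖T‖ := by
    refine (norm_nonneg T).lt_of_ne fun h0 => ?_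
    have := key v₀ hv₀ hv₀'
    rw [← h0, zero_mul] at this
    exact absurd this (not_le.2 (by positivity))
  have : c + ‖T‖⁻¹ ≤ c := by
    refine le_csInf ⟨_, v₀, hv₀, hv₀', rfl⟩ ?_
    rintro _ ⟨v, hv, hv', rfl⟩
    have hpos : 0 < ‖v.fst‖ ^ 2 := by positivity
    rw [le_div_iff₀ hpos]
    have h1 : ‖T‖⁻¹ * ‖v.fst‖ ^ 2 ≤ ‖T‖⁻¹ * (‖T‖ * (‖v.snd‖ ^ 2 - c * ‖v.fst‖ ^ 2)) :=
      mul_le_mul_of_nonneg_left (key v hv hv') (by positivity)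
    rw [inv_mul_cancel_left₀ hTpos.ne'] at h1
    linarith
  linarith [inv_pos.2 hTpos]

theorem isLeast_dirichletSpectrum {n : ℕ} {O : Set (EuclideanSpace ℝ (Fin n))}
    (hne : ∃ v ∈ H10 O, v.fst ≠ 0) : IsLeast (dirichletSpectrum O) (rayleighBottom O) :=
  ⟨rayleighBottom_mem_dirichletSpectrum hne, fun _ hμ => not_lt.1 fun h =>
    hμ (mem_dirichletResolventSet_of_lt_rayleighBottom h)⟩

lemma spectralBottom_eq {n : ℕ} {O : Set (EuclideanSpace ℝ (Fin n))}
    (hne : ∃ v ∈ H10 O, v.fst ≠ 0) : spectralBottom O = rayleighBottom O :=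
  (isLeast_dirichletSpectrum hne).csInf_eq

lemma isGLB_spectralBottom {n : ℕ} {O : Set (EuclideanSpace ℝ (Fin n))}
    (hne : ∃ v ∈ H10 O, v.fst ≠ 0) : IsGLB (dirichletSpectrum O) (spectralBottom O) :=
  spectralBottom_eq hne ▸ (isLeast_dirichletSpectrum hne).isGLB

/-! ### Gradients and test functions -/

section Gradient

variable {F : Type*} [NormedAddCommGroup F] [InnerProductSpace ℝ F] [CompleteSpace F]
  {f g : F → ℝ} {f' g' x : F}

lemma HasGradientAt.fun_add (hf : HasGradientAt f f' x) (hg : HasGradientAt g g' x) :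
    HasGradientAt (fun y => f y + g y) (f' + g') x := by
  rw [hasGradientAt_iff_hasFDerivAt] at *
  simpa only [map_add] using hf.fun_add hg

lemma HasGradientAt.fun_mul (hf : HasGradientAt f f' x) (hg : HasGradientAt g g' x) :
    HasGradientAt (fun y => f y * g y) (f x • g' + g x • f') x := by
  rw [hasGradientAt_iff_hasFDerivAt] at *
  simpa only [map_add, map_smulₛₗ, conj_trivial] using hf.fun_mul hg

lemma HasDerivAt.comp_hasGradientAt {h : ℝ → ℝ} {h' : ℝ} (hh : HasDerivAt h h' (f x))
    (hf : HasGradientAt f f' x) : HasGradientAt (fun y => h (f y)) (h' • f') x := by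
  rw [hasGradientAt_iff_hasFDerivAt] at *
  simpa only [map_smulₛₗ, conj_trivial, Function.comp_def] using hh.comp_hasFDerivAt x hf

end Gradient

namespace IsTestFunction

variable {n : ℕ} {O O' : Set (EuclideanSpace ℝ (Fin n))} {φ ψ : EuclideanSpace ℝ (Fin n) → ℝ}

lemma mono (hφ : IsTestFunction O φ) (h : O ⊆ O') : IsTestFunction O' φ :=
  ⟨hφ.contDiff, hφ.hasCompactSupport, hφ.tsupport_subset.trans h⟩

/-- A smooth function that vanishes wherever a test function vanishes is a test function. -/
lemma of_eq_zero (hφ : IsTestFunction O φ) (hψ : ContDiff ℝ ∞ ψ) (h : ∀ x, φ x = 0 → ψ x = 0) :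
    IsTestFunction O ψ := by
  have hs : Function.support ψ ⊆ Function.support φ := fun x hx h' => hx (h x h')
  exact ⟨hψ, hφ.hasCompactSupport.mono hs, (closure_mono hs).trans hφ.tsupport_subset⟩

lemma eq_zero (hφ : IsTestFunction O φ) {x : EuclideanSpace ℝ (Fin n)} (hx : x ∉ O) : φ x = 0 :=
  image_eq_zero_of_notMem_tsupport fun h => hx (hφ.tsupport_subset h)

lemma continuous (hφ : IsTestFunction O φ) : Continuous φ := hφ.contDiff.continuous

lemma hasGradientAt (hφ : IsTestFunction O φ) (x : EuclideanSpace ℝ (Fin n)) :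
    HasGradientAt φ (gradient φ x) x :=
  ((hφ.contDiff.differentiable (by simp)) x).hasGradientAt

lemma continuous_gradient (hφ : IsTestFunction O φ) : Continuous (gradient φ) :=
  (LinearIsometryEquiv.continuous _).comp (hφ.contDiff.continuous_fderiv (by simp))

lemma support_gradient_subset (φ : EuclideanSpace ℝ (Fin n) → ℝ) :
    Function.support (gradient φ) ⊆ tsupport φ := by
  intro x hx
  refine support_fderiv_subset ℝ (f := φ) fun h => hx ?_
  simp [gradient, h]

lemma gradient_eq_zero (hφ : IsTestFunction O φ) {x : EuclideanSpace ℝ (Fin n)} (hx : x ∉ O) :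
    gradient φ x = 0 :=
  Function.notMem_support.1 fun h => hx (hφ.tsupport_subset (support_gradient_subset φ h))

lemma hasCompactSupport_gradient (hφ : IsTestFunction O φ) : HasCompactSupport (gradient φ) :=
  hφ.hasCompactSupport.mono' (support_gradient_subset φ)

/-- A continuous function that vanishes wherever a test function and its gradient vanish is
integrable. -/
lemma integrable_of_eq_zero {E : Type*} [NormedAddCommGroup E]
    (hφ : IsTestFunction O φ) {f : EuclideanSpace ℝ (Fin n) → E} (hf : Continuous f)
    (h : ∀ x, φ x = 0 → gradient φ x = 0 → f x = 0) : Integrable f := by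
  refine hf.integrable_of_hasCompactSupport (hφ.hasCompactSupport.mono' fun x hx => ?_)
  by_contra hx'
  exact hx (h x (image_eq_zero_of_notMem_tsupport hx')
    (Function.notMem_support.1 fun h => hx' (support_gradient_subset φ h)))

lemma integrable_sq (hφ : IsTestFunction O φ) : Integrable fun x => φ x ^ 2 :=
  hφ.integrable_of_eq_zero (hφ.continuous.pow 2) (by simp +contextual)

lemma integrable_norm_gradient_sq (hφ : IsTestFunction O φ) :
    Integrable fun x => ‖gradient φ x‖ ^ 2 :=
  hφ.integrable_of_eq_zero (hφ.continuous_gradient.norm.pow 2) (by simp +contextual)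

lemma integrable_energy (hφ : IsTestFunction O φ) (c : ℝ) :
    Integrable fun x => ‖gradient φ x‖ ^ 2 - c * φ x ^ 2 :=
  hφ.integrable_norm_gradient_sq.sub (hφ.integrable_sq.const_mul c)

lemma memLp_two (hφ : IsTestFunction O φ) : MemLp φ 2 :=
  hφ.continuous.memLp_of_hasCompactSupport hφ.hasCompactSupport

lemma memLp_two_gradient (hφ : IsTestFunction O φ) : MemLp (gradient φ) 2 :=
  hφ.continuous_gradient.memLp_of_hasCompactSupport hφ.hasCompactSupport_gradient

end IsTestFunction

/-- The shifted Dirichlet energy `‖∇φ‖² - c ‖φ‖²` of a function on the whole space. -/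
noncomputable def shiftedEnergy {n : ℕ} (c : ℝ) (φ : EuclideanSpace ℝ (Fin n) → ℝ) : ℝ :=
  ∫ x, (‖gradient φ x‖ ^ 2 - c * φ x ^ 2)

section Pairs

variable {n : ℕ} {O : Set (EuclideanSpace ℝ (Fin n))} {φ : EuclideanSpace ℝ (Fin n) → ℝ}

lemma IsTestFunction.shiftedEnergy_eq (hφ : IsTestFunction O φ) (c : ℝ) :
    shiftedEnergy c φ = (∫ x, ‖gradient φ x‖ ^ 2) - c * ∫ x, φ x ^ 2 := by
  rw [shiftedEnergy, integral_sub hφ.integrable_norm_gradient_sq (hφ.integrable_sq.const_mul c),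
    integral_const_mul]

lemma norm_sq_eq_integral {E : Type*} [NormedAddCommGroup E] [InnerProductSpace ℝ E]
    (f : Lp E 2 (volume.restrict O)) : ‖f‖ ^ 2 = ∫ x in O, ‖f x‖ ^ 2 := by
  rw [← real_inner_self_eq_norm_sq, MeasureTheory.L2.inner_def]
  simp

lemma IsTestFunction.norm_sq_fst (hφ : IsTestFunction O φ) {v : WithLp 2 (L2 O × L2Field O)}
    (h : v.fst =ᵐ[volume.restrict O] φ) : ‖v.fst‖ ^ 2 = ∫ x, φ x ^ 2 := by
  rw [norm_sq_eq_integral, integral_congr_ae (g := fun x => φ x ^ 2)]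
  · exact setIntegral_eq_integral_of_forall_compl_eq_zero fun x hx => by simp [hφ.eq_zero hx]
  · filter_upwards [h] with x hx
    simp [hx]

lemma IsTestFunction.norm_sq_snd (hφ : IsTestFunction O φ) {v : WithLp 2 (L2 O × L2Field O)}
    (h : v.snd =ᵐ[volume.restrict O] gradient φ) : ‖v.snd‖ ^ 2 = ∫ x, ‖gradient φ x‖ ^ 2 := by
  rw [norm_sq_eq_integral, integral_congr_ae (g := fun x => ‖gradient φ x‖ ^ 2)]
  · exact setIntegral_eq_integral_of_forall_compl_eq_zero fun x hx => by
      simp [hφ.gradient_eq_zero hx]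
  · filter_upwards [h] with x hx
    simp [hx]

lemma IsTestFunction.exists_mem_H10 (hφ : IsTestFunction O φ) :
    ∃ v ∈ H10 O, v.fst =ᵐ[volume.restrict O] φ ∧ v.snd =ᵐ[volume.restrict O] gradient φ := by
  have h1 := (hφ.memLp_two.restrict O).coeFn_toLp
  have h2 := (hφ.memLp_two_gradient.restrict O).coeFn_toLp
  exact ⟨WithLp.toLp 2 ((hφ.memLp_two.restrict O).toLp, (hφ.memLp_two_gradient.restrict O).toLp),
    (testPairs O).le_topologicalClosure ⟨φ, hφ, h1, h2⟩, h1, h2⟩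

lemma IsTestFunction.shiftedEnergy_nonneg (hφ : IsTestFunction O φ) {c : ℝ}
    (hc : c ≤ rayleighBottom O) : 0 ≤ shiftedEnergy c φ := by
  obtain ⟨v, hv, h1, h2⟩ := hφ.exists_mem_H10
  have := rayleighBottom_mul_le hv
  rw [hφ.norm_sq_fst h1, hφ.norm_sq_snd h2] at this
  rw [hφ.shiftedEnergy_eq]
  have h0 : 0 ≤ ∫ x, φ x ^ 2 := integral_nonneg fun x => sq_nonneg _
  nlinarith

/-- Smooth approximation of `|φ|` by the functions `√(φ² + δ²) - δ`. -/
lemma IsTestFunction.exists_nonneg_approx (hφ : IsTestFunction O φ) {c τ : ℝ} (hc : 0 ≤ c)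
    (hτ : 0 < τ) : ∃ p, IsTestFunction O p ∧ (∀ x, 0 ≤ p x) ∧
      ∫ x, (|φ x| - p x) ^ 2 ≤ τ ∧ shiftedEnergy c p ≤ shiftedEnergy c φ + τ := by
  set N := ∫ x, |φ x|
  have hN0 : 0 ≤ N := integral_nonneg fun x => abs_nonneg _
  have hNi : Integrable fun x => |φ x| :=
    hφ.integrable_of_eq_zero hφ.continuous.abs (by simp +contextual)
  have hden : 0 < (1 + 2 * c) * N + 1 := by positivity
  set δ := τ / ((1 + 2 * c) * N + 1)
  have hδ : 0 < δ := by positivity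
  have hδN : δ * ((1 + 2 * c) * N) ≤ τ := by
    have : δ * ((1 + 2 * c) * N + 1) = τ := div_mul_cancel₀ _ hden.ne'
    linarith
  have hpos (x) : 0 < φ x ^ 2 + δ ^ 2 := by positivity
  set p := fun x => √(φ x ^ 2 + δ ^ 2) - δ with hp
  have hp0 (x) : 0 ≤ p x := sub_nonneg.2 (Real.le_sqrt_of_sq_le (by nlinarith [sq_nonneg (φ x)]))
  have hp1 (x) : p x ≤ |φ x| := by
    rw [hp, sub_le_iff_le_add, Real.sqrt_le_left (by positivity)]
    nlinarith [sq_abs (φ x), mul_nonneg (abs_nonneg (φ x)) hδ.le]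
  have hp2 (x) : |φ x| - p x ≤ δ := by
    have : |φ x| ≤ √(φ x ^ 2 + δ ^ 2) := Real.abs_le_sqrt (by nlinarith [sq_nonneg δ])
    simp only [hp]; linarith
  have hpt : IsTestFunction O p := by
    refine hφ.of_eq_zero (((hφ.contDiff.pow 2).add contDiff_const).sqrt
      (fun x => (hpos x).ne') |>.sub contDiff_const) fun x hx => ?_
    simp [hp, hx, Real.sqrt_sq hδ.le]
  have hgrad (x) : ‖gradient p x‖ ≤ ‖gradient φ x‖ := by
    have hs : HasDerivAt (fun t : ℝ => √(t ^ 2 + δ ^ 2) - δ)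
        (2 * φ x / (2 * √(φ x ^ 2 + δ ^ 2))) (φ x) := by
      have := (((hasDerivAt_pow 2 (φ x)).add_const (δ ^ 2)).sqrt (hpos x).ne').sub_const δ
      simpa using this
    rw [(hs.comp_hasGradientAt (hφ.hasGradientAt x)).gradient, norm_smul]
    refine mul_le_of_le_one_left (norm_nonneg _) ?_
    rw [mul_div_mul_left _ _ two_ne_zero, norm_div, Real.norm_eq_abs, Real.norm_eq_abs,
      abs_of_nonneg (Real.sqrt_nonneg _)]
    exact div_le_one_of_le₀ (Real.abs_le_sqrt (by nlinarith [sq_nonneg δ])) (Real.sqrt_nonneg _)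
  refine ⟨p, hpt, hp0, ?_, ?_⟩
  · calc ∫ x, (|φ x| - p x) ^ 2 ≤ ∫ x, δ * |φ x| := by
          refine integral_mono_of_nonneg (.of_forall fun x => sq_nonneg _) (hNi.const_mul δ)
            (.of_forall fun x => ?_)
          have := hp0 x; have := hp1 x; have := hp2 x
          change (|φ x| - p x) ^ 2 ≤ δ * |φ x|
          rw [sq]
          exact mul_le_mul (hp2 x) (by linarith) (by linarith) hδ.le
      _ = δ * N := integral_const_mul _ _
      _ ≤ τ := by nlinarith [mul_nonneg hδ.le (mul_nonneg hc hN0)]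
  · calc shiftedEnergy c p
        ≤ ∫ x, ((‖gradient φ x‖ ^ 2 - c * φ x ^ 2) + 2 * c * δ * |φ x|) := by
          refine integral_mono (hpt.integrable_energy c)
            ((hφ.integrable_energy c).add (hNi.const_mul _)) fun x => ?_
          have h1 : ‖gradient p x‖ ^ 2 ≤ ‖gradient φ x‖ ^ 2 :=
            pow_le_pow_left₀ (norm_nonneg _) (hgrad x) 2
          have h2 : φ x ^ 2 - p x ^ 2 ≤ 2 * δ * |φ x| := by
            rw [← sq_abs (φ x)]
            nlinarith [hp0 x, hp1 x, hp2 x, abs_nonneg (φ x)]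
          have h3 := mul_le_mul_of_nonneg_left h2 hc
          change ‖gradient p x‖ ^ 2 - c * p x ^ 2 ≤ _
          linarith
      _ = shiftedEnergy c φ + 2 * c * δ * N := by
          rw [integral_add (hφ.integrable_energy c) (hNi.const_mul _), integral_const_mul,
            shiftedEnergy]
      _ ≤ shiftedEnergy c φ + τ := by nlinarith [mul_nonneg hδ.le hN0]

end Pairs

/-- The modulus of a minimizer of the Rayleigh quotient, extended by zero, is approximated in `L²`
by non-negative test functions that are minimizing as well. -/
theorem exists_nonneg_minimizer {n : ℕ} {Q : Set (EuclideanSpace ℝ (Fin n))} (hQ : IsOpen Q)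
    {w : WithLp 2 (L2 Q × L2Field Q)} (hw : w ∈ H10 Q) (hw0 : w.fst ≠ 0) {c : ℝ} (hc : 0 ≤ c)
    (hmin : ‖w.snd‖ ^ 2 ≤ c * ‖w.fst‖ ^ 2) :
    ∃ u : EuclideanSpace ℝ (Fin n) → ℝ, Measurable u ∧ (∀ x, 0 ≤ u x) ∧ (∀ x ∉ Q, u x = 0) ∧
      MemLp u 2 ∧ ¬ u =ᵐ[volume] 0 ∧ ∀ τ > 0, ∃ p, IsTestFunction Q p ∧ (∀ x, 0 ≤ p x) ∧
        ∫ x, (p x - u x) ^ 2 ≤ τ ∧ shiftedEnergy c p ≤ τ := by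
  have hUm : Measurable (w.fst : EuclideanSpace ℝ (Fin n) → ℝ) :=
    (Lp.stronglyMeasurable w.fst).measurable
  set u := Q.indicator fun x => |w.fst x| with hu
  have huM : MemLp u 2 :=
    (memLp_indicator_iff_restrict hQ.measurableSet).2 (Lp.memLp w.fst).abs
  refine ⟨u, hUm.abs.indicator hQ.measurableSet, indicator_nonneg fun _ _ => abs_nonneg _,
    fun x hx => indicator_of_notMem hx _, huM, fun h => hw0 ?_, fun τ hτ => ?_⟩
  · rw [Lp.eq_zero_iff_ae_eq_zero]
    filter_upwards [ae_restrict_of_ae h, ae_restrict_mem hQ.measurableSet] with x hx hxQ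
    simpa [hu, hxQ] using hx
  · have hcont : Continuous fun v : WithLp 2 (L2 Q × L2Field Q) =>
        ‖v.fst - w.fst‖ ^ 2 := by
      have := (WithLp.fstL 2 ℝ (L2 Q) (L2Field Q)).continuous
      exact (this.sub continuous_const).norm.pow 2
    have hcont' : Continuous fun v : WithLp 2 (L2 Q × L2Field Q) =>
        ‖v.snd‖ ^ 2 - c * ‖v.fst‖ ^ 2 := by
      have h1 := (WithLp.fstL 2 ℝ (L2 Q) (L2Field Q)).continuous
      have h2 := (WithLp.sndL 2 ℝ (L2 Q) (L2Field Q)).continuous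
      exact (h2.norm.pow 2).sub (continuous_const.mul (h1.norm.pow 2))
    have hopen : IsOpen {v : WithLp 2 (L2 Q × L2Field Q) | ‖v.fst - w.fst‖ ^ 2 < τ / 4 ∧
        ‖v.snd‖ ^ 2 - c * ‖v.fst‖ ^ 2 < τ / 2} :=
      (isOpen_lt hcont continuous_const).inter (isOpen_lt hcont' continuous_const)
    obtain ⟨v, ⟨hv1, hv2⟩, φ, hφ, h1, h2⟩ := mem_closure_iff.1 hw _ hopen
      ⟨by simp [hτ], by linarith⟩
    obtain ⟨p, hp, hp0, hp1, hp2⟩ := hφ.exists_nonneg_approx hc (τ := τ / 4) (by linarith)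
    refine ⟨p, hp, hp0, ?_, ?_⟩
    · have e1 : ∫ x, (|φ x| - u x) ^ 2 ≤ τ / 4 := by
        refine le_trans ?_ hv1.le
        rw [norm_sq_eq_integral, ← integral_indicator hQ.measurableSet]
        refine le_of_eq_of_le (integral_congr_ae
          (g := Q.indicator fun x => (|φ x| - |w.fst x|) ^ 2) (.of_forall fun x => ?_)) ?_
        · by_cases hx : x ∈ Q
          · simp [hu, hx]
          · simp [hu, hx, hφ.eq_zero hx]
        rw [integral_indicator hQ.measurableSet, integral_indicator hQ.measurableSet]
        refine integral_mono_of_nonneg (.of_forall fun x => sq_nonneg _)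
          (by simpa using (Lp.memLp (v.fst - w.fst)).integrable_norm_pow (by simp)) ?_
        filter_upwards [h1, Lp.coeFn_sub v.fst w.fst] with x hx hx'
        change (|φ x| - |w.fst x|) ^ 2 ≤ ‖(v.fst - w.fst : L2 Q) x‖ ^ 2
        rw [hx', Pi.sub_apply, hx, Real.norm_eq_abs]
        exact sq_le_sq.2 (by rw [abs_abs]; exact abs_abs_sub_abs_le_abs_sub _ _)
      have i1 : Integrable fun x => (|φ x| - u x) ^ 2 := (hφ.memLp_two.abs.sub huM).integrable_sq
      have i2 : Integrable fun x => (|φ x| - p x) ^ 2 :=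
        (hφ.memLp_two.abs.sub hp.memLp_two).integrable_sq
      calc ∫ x, (p x - u x) ^ 2
          ≤ ∫ x, (2 * (|φ x| - u x) ^ 2 + 2 * (|φ x| - p x) ^ 2) := by
            refine integral_mono (hp.memLp_two.sub huM).integrable_sq
              ((i1.const_mul 2).add (i2.const_mul 2)) fun x => ?_
            change (p x - u x) ^ 2 ≤ _
            nlinarith [sq_nonneg ((|φ x| - u x) + (|φ x| - p x))]
        _ = 2 * (∫ x, (|φ x| - u x) ^ 2) + 2 * ∫ x, (|φ x| - p x) ^ 2 := by
            rw [integral_add (i1.const_mul 2) (i2.const_mul 2), integral_const_mul,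
              integral_const_mul]
        _ ≤ τ := by linarith
    · rw [hφ.norm_sq_fst h1, hφ.norm_sq_snd h2, ← hφ.shiftedEnergy_eq] at hv2
      linarith

/-! ### Products of functions of the cross-section and of the axial coordinate -/

section Product

variable {d : ℕ}

/-- The projection of `ℝ^(d+1)` onto the first `d` coordinates. -/
noncomputable def crossProj : EuclideanSpace ℝ (Fin (d + 1)) →L[ℝ] EuclideanSpace ℝ (Fin d) :=
  LinearMap.toContinuousLinearMap
    { toFun := fun x => WithLp.toLp 2 fun i : Fin d => x i.castSucc
      map_add' := fun _ _ => rfl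
      map_smul' := fun _ _ => rfl }

@[simp] lemma crossProj_apply (x : EuclideanSpace ℝ (Fin (d + 1))) (i : Fin d) :
    crossProj x i = x i.castSucc := rfl

lemma continuous_axial : Continuous fun x : EuclideanSpace ℝ (Fin (d + 1)) => x (Fin.last d) :=
  (EuclideanSpace.proj (𝕜 := ℝ) (Fin.last d)).continuous

lemma measurePreserving_split : MeasurePreserving
    (fun x : EuclideanSpace ℝ (Fin (d + 1)) => (crossProj x, x (Fin.last d))) volume
    (volume.prod volume) := by
  have h1 := PiLp.volume_preserving_ofLp (Fin (d + 1))
  have h2 := volume_preserving_piFinSuccAbove (fun _ : Fin (d + 1) => ℝ) (Fin.last d)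
  have h3 : MeasurePreserving (Prod.swap : ℝ × (Fin d → ℝ) → _) (volume.prod volume)
      (volume.prod volume) := Measure.measurePreserving_swap
  have h4 := (PiLp.volume_preserving_toLp (Fin d)).prod (MeasurePreserving.id (volume : Measure ℝ))
  have e : (fun x : EuclideanSpace ℝ (Fin (d + 1)) => (crossProj x, x (Fin.last d))) =
      Prod.map (WithLp.toLp 2) id ∘ Prod.swap ∘
        MeasurableEquiv.piFinSuccAbove (fun _ => ℝ) (Fin.last d) ∘ WithLp.ofLp := by
    funext x
    refine Prod.ext (PiLp.ext fun i => ?_) ?_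
    · simp [MeasurableEquiv.piFinSuccAbove, Fin.init]
    · simp [MeasurableEquiv.piFinSuccAbove]
  rw [e]
  exact h4.comp (h3.comp (h2.comp h1))

lemma integral_crossProj_mul {f : EuclideanSpace ℝ (Fin d) → ℝ} {g : ℝ → ℝ} (hf : Measurable f)
    (hg : Measurable g) :
    ∫ x : EuclideanSpace ℝ (Fin (d + 1)), f (crossProj x) * g (x (Fin.last d)) =
      (∫ y, f y) * ∫ t, g t := by
  rw [← integral_prod_mul, ← measurePreserving_split.map_eq,
    integral_map measurePreserving_split.measurable.aemeasurable]
  exact ((hf.comp measurable_fst).mul (hg.comp measurable_snd)).aestronglyMeasurable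

lemma hasGradientAt_comp_crossProj {f : EuclideanSpace ℝ (Fin d) → ℝ}
    {x : EuclideanSpace ℝ (Fin (d + 1))} {f' : EuclideanSpace ℝ (Fin d)}
    (hf : HasGradientAt f f' (crossProj x)) :
    HasGradientAt (fun y => f (crossProj y))
      (WithLp.toLp 2 (Fin.snoc (α := fun _ => ℝ) f' 0) : EuclideanSpace ℝ (Fin (d + 1))) x := by
  rw [hasGradientAt_iff_hasFDerivAt] at *
  refine (hf.comp x crossProj.hasFDerivAt).congr_fderiv (ContinuousLinearMap.ext fun v => ?_)
  simp [PiLp.inner_apply, Fin.sum_univ_castSucc]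

lemma hasGradientAt_comp_axial {g : ℝ → ℝ} {x : EuclideanSpace ℝ (Fin (d + 1))} {g' : ℝ}
    (hg : HasDerivAt g g' (x (Fin.last d))) :
    HasGradientAt (fun y : EuclideanSpace ℝ (Fin (d + 1)) => g (y (Fin.last d)))
      (EuclideanSpace.single (Fin.last d) g') x := by
  rw [hasGradientAt_iff_hasFDerivAt]
  refine (hg.comp_hasFDerivAt x
    (EuclideanSpace.proj (𝕜 := ℝ) (Fin.last d)).hasFDerivAt).congr_fderiv
    (ContinuousLinearMap.ext fun v => ?_)
  simp [EuclideanSpace.inner_single_left]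

variable {Q : Set (EuclideanSpace ℝ (Fin d))} {p : EuclideanSpace ℝ (Fin d) → ℝ} {χ : ℝ → ℝ}

lemma IsTestFunction.cylinder (hp : IsTestFunction Q p) (hχ : ContDiff ℝ ∞ χ)
    (hχc : HasCompactSupport χ) : IsTestFunction (cylinderOver Q)
      fun x : EuclideanSpace ℝ (Fin (d + 1)) => p (crossProj x) * χ (x (Fin.last d)) := by
  have hsnoc : Continuous fun z : EuclideanSpace ℝ (Fin d) × ℝ =>
      (WithLp.toLp 2 (Fin.snoc (α := fun _ => ℝ) z.1 z.2) : EuclideanSpace ℝ (Fin (d + 1))) := by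
    refine (PiLp.continuous_toLp 2 _).comp (continuous_pi fun i => ?_)
    refine Fin.lastCases ?_ (fun j => ?_) i
    · simpa using continuous_snd
    · simpa [Function.comp_def] using
        (EuclideanSpace.proj (𝕜 := ℝ) j).continuous.comp continuous_fst
  refine ⟨(hp.contDiff.comp crossProj.contDiff).mul
    (hχ.comp (EuclideanSpace.proj (𝕜 := ℝ) (Fin.last d)).contDiff), ?_, ?_⟩
  · refine HasCompactSupport.intro ((hp.hasCompactSupport.prod hχc).image hsnoc) fun x hx => ?_
    by_contra h
    obtain ⟨h1, h2⟩ := mul_ne_zero_iff.1 h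
    refine hx ⟨(crossProj x, x (Fin.last d)), ⟨subset_tsupport _ h1, subset_tsupport _ h2⟩, ?_⟩
    ext i
    refine Fin.lastCases ?_ (fun j => ?_) i <;> simp
  · refine (closure_minimal (fun x hx => ?_)
      ((isClosed_tsupport p).preimage crossProj.continuous)).trans
      (preimage_mono hp.tsupport_subset)
    exact subset_tsupport _ (left_ne_zero_of_mul hx)

lemma shiftedEnergy_cylinder (hp : IsTestFunction Q p) (hχ : ContDiff ℝ ∞ χ)
    (hχc : HasCompactSupport χ) (c : ℝ) :
    shiftedEnergy c (fun x : EuclideanSpace ℝ (Fin (d + 1)) =>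
      p (crossProj x) * χ (x (Fin.last d))) =
      shiftedEnergy c p * (∫ t, χ t ^ 2) + (∫ y, p y ^ 2) * ∫ t, deriv χ t ^ 2 := by
  have hgrad (x : EuclideanSpace ℝ (Fin (d + 1))) :
      ‖gradient (fun x : EuclideanSpace ℝ (Fin (d + 1)) =>
        p (crossProj x) * χ (x (Fin.last d))) x‖ ^ 2 =
      ‖gradient p (crossProj x)‖ ^ 2 * χ (x (Fin.last d)) ^ 2 +
        p (crossProj x) ^ 2 * deriv χ (x (Fin.last d)) ^ 2 := by
    have h1 := hasGradientAt_comp_crossProj (hp.hasGradientAt (crossProj x))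
    have h2 := hasGradientAt_comp_axial (x := x)
      ((hχ.differentiable (by simp)) (x (Fin.last d))).hasDerivAt
    rw [(h1.fun_mul h2).gradient, EuclideanSpace.norm_sq_eq, EuclideanSpace.norm_sq_eq,
      Fin.sum_univ_castSucc, Finset.sum_mul]
    simp [mul_pow, mul_comm, Fin.castSucc_ne_last]
  have hχ' : Continuous (deriv χ) := hχ.continuous_deriv (by simp)
  have i1 : Integrable fun t => χ t ^ 2 :=
    (hχ.continuous.memLp_of_hasCompactSupport hχc (p := 2)).integrable_sq
  have i2 : Integrable fun t => deriv χ t ^ 2 :=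
    (hχ'.memLp_of_hasCompactSupport hχc.deriv (p := 2)).integrable_sq
  have e : shiftedEnergy c (fun x : EuclideanSpace ℝ (Fin (d + 1)) =>
      p (crossProj x) * χ (x (Fin.last d))) =
      ∫ x : EuclideanSpace ℝ (Fin (d + 1)),
        ((‖gradient p (crossProj x)‖ ^ 2 - c * p (crossProj x) ^ 2) * χ (x (Fin.last d)) ^ 2 +
          p (crossProj x) ^ 2 * deriv χ (x (Fin.last d)) ^ 2) := by
    refine integral_congr_ae (.of_forall fun x => ?_)
    simp only [hgrad]
    ring
  have j1 : Integrable fun x : EuclideanSpace ℝ (Fin (d + 1)) =>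
      (‖gradient p (crossProj x)‖ ^ 2 - c * p (crossProj x) ^ 2) * χ (x (Fin.last d)) ^ 2 :=
    measurePreserving_split.integrable_comp_of_integrable ((hp.integrable_energy c).mul_prod i1)
  have j2 : Integrable fun x : EuclideanSpace ℝ (Fin (d + 1)) =>
      p (crossProj x) ^ 2 * deriv χ (x (Fin.last d)) ^ 2 :=
    measurePreserving_split.integrable_comp_of_integrable (hp.integrable_sq.mul_prod i2)
  rw [e, integral_add j1 j2, shiftedEnergy,
    integral_crossProj_mul (f := fun y => ‖gradient p y‖ ^ 2 - c * p y ^ 2)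
      (g := fun t => χ t ^ 2), integral_crossProj_mul (f := fun y => p y ^ 2)
      (g := fun t => deriv χ t ^ 2)]
  · exact (hp.continuous.pow 2).measurable
  · exact (hχ'.pow 2).measurable
  · exact ((hp.continuous_gradient.norm.pow 2).sub
      (continuous_const.mul (hp.continuous.pow 2))).measurable
  · exact (hχ.continuous.pow 2).measurable

end Product

/-- Cut-off functions `t ↦ χ (t / T)` on the line, whose derivative is small in `L²`. -/
lemma exists_axial_cutoff : ∃ A B : ℝ, ∀ T > 0, ∃ χ : ℝ → ℝ, ContDiff ℝ ∞ χ ∧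
    HasCompactSupport χ ∧ (∀ t, 0 ≤ χ t) ∧ (∀ t, |t| ≤ T → χ t = 1) ∧
    ∫ t, χ t ^ 2 = T * A ∧ ∫ t, deriv χ t ^ 2 = B / T := by
  let χ : ContDiffBump (0 : ℝ) := ⟨1, 2, one_pos, one_lt_two⟩
  refine ⟨∫ t, χ t ^ 2, ∫ t, deriv χ t ^ 2, fun T hT => ⟨fun t => χ (t / T), ?_, ?_,
    fun t => χ.nonneg, fun t ht => ?_, ?_, ?_⟩⟩
  · exact χ.contDiff.comp (contDiff_id.div_const T)
  · exact χ.hasCompactSupport.comp_homeomorph (Homeomorph.mulRight₀ T⁻¹ (inv_ne_zero hT.ne'))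
  · refine χ.one_of_mem_closedBall ?_
    rw [mem_closedBall_zero_iff, Real.norm_eq_abs, abs_div, abs_of_pos hT]
    exact (div_le_one hT).2 ht
  · rw [Measure.integral_comp_div (fun t => χ t ^ 2), abs_of_pos hT, smul_eq_mul]
  · have (t : ℝ) : deriv (fun t => χ (t / T)) t ^ 2 = (fun t => T⁻¹ ^ 2 * deriv χ t ^ 2) (t / T) := by
      have h := ((χ.contDiff (n := 1)).differentiable one_ne_zero (t / T)).hasDerivAt.comp t
        ((hasDerivAt_id t).div_const T)
      rw [show deriv (fun t => χ (t / T)) t = _ from h.deriv]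
      ring
    simp_rw [this]
    rw [Measure.integral_comp_div (fun t => T⁻¹ ^ 2 * deriv χ t ^ 2), abs_of_pos hT, smul_eq_mul,
      integral_const_mul]
    field_simp

/-- Multiplying a minimizing sequence of the cross-section by a long cut-off gives test functions
on the cylinder of almost vanishing shifted energy. -/
theorem exists_cylinder_minimizer {d : ℕ} {Q : Set (EuclideanSpace ℝ (Fin d))}
    {u : EuclideanSpace ℝ (Fin d) → ℝ} {c : ℝ} (hum : Measurable u) (hu : MemLp u 2)
    (happ : ∀ τ > 0, ∃ p, IsTestFunction Q p ∧ (∀ x, 0 ≤ p x) ∧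
      ∫ x, (p x - u x) ^ 2 ≤ τ ∧ shiftedEnergy c p ≤ τ) {τ k : ℝ} (hτ : 0 < τ) (hk : 0 ≤ k) :
    ∃ w : EuclideanSpace ℝ (Fin (d + 1)) → ℝ, IsTestFunction (cylinderOver Q) w ∧
      (∀ x, 0 ≤ w x) ∧ shiftedEnergy c w ≤ τ ∧
      ∫ x in {x | |x (Fin.last d)| ≤ k}, (w x - u (crossProj x)) ^ 2 ≤ τ := by
  obtain ⟨A, B, hχ⟩ := exists_axial_cutoff
  have hA : 0 ≤ A := by
    obtain ⟨χ, -, -, -, -, h, -⟩ := hχ 1 one_pos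
    rw [one_mul] at h
    exact h ▸ integral_nonneg fun t => sq_nonneg _
  have hB : 0 ≤ B := by
    obtain ⟨χ, -, -, -, -, -, h⟩ := hχ 1 one_pos
    rw [div_one] at h
    exact h ▸ integral_nonneg fun t => sq_nonneg _
  set N := ∫ y, u y ^ 2
  have hN : 0 ≤ N := integral_nonneg fun t => sq_nonneg _
  -- the cut-off is chosen first: the bound on `‖p‖` does not depend on the approximant `p`
  set T := k + 2 * ((2 + 2 * N) * B) / τ + 1
  have hT : 0 < T := by positivity
  have hTk : k ≤ T := by
    have : 0 ≤ 2 * ((2 + 2 * N) * B) / τ := by positivity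
    simp only [T]; linarith
  have hTB : (2 + 2 * N) * (B / T) ≤ τ / 2 := by
    rw [← mul_div_assoc, div_le_iff₀ hT]
    have h1 : 2 * ((2 + 2 * N) * B) / τ ≤ T := by simp only [T]; linarith
    have h2 := (div_le_iff₀ hτ).1 h1
    linarith
  obtain ⟨χ, hχ1, hχ2, hχ3, hχ4, hχ5, hχ6⟩ := hχ T hT
  have hden : 0 < 2 * (T * A) + 2 * k + 1 := by positivity
  obtain ⟨p, hp, hp0, hpu, hpe⟩ := happ (min 1 (τ / (2 * (T * A) + 2 * k + 1))) (by positivity)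
  obtain ⟨hpu1, hpu2⟩ := le_min_iff.1 hpu
  replace hpe := hpe.trans (min_le_right _ _)
  rw [le_div_iff₀ hden] at hpu2 hpe
  have hpu0 : 0 ≤ ∫ x, (p x - u x) ^ 2 := integral_nonneg fun x => sq_nonneg _
  refine ⟨fun x => p (crossProj x) * χ (x (Fin.last d)), hp.cylinder hχ1 hχ2,
    fun x => mul_nonneg (hp0 _) (hχ3 _), ?_, ?_⟩
  · have hpN : ∫ y, p y ^ 2 ≤ 2 + 2 * N := by
      have i1 : Integrable fun y => (p y - u y) ^ 2 := (hp.memLp_two.sub hu).integrable_sq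
      calc ∫ y, p y ^ 2 ≤ ∫ y, (2 * (p y - u y) ^ 2 + 2 * u y ^ 2) := by
            refine integral_mono hp.integrable_sq
              ((i1.const_mul 2).add (hu.integrable_sq.const_mul 2)) fun y => ?_
            change p y ^ 2 ≤ _
            nlinarith [sq_nonneg (p y - 2 * u y)]
        _ = 2 * (∫ y, (p y - u y) ^ 2) + 2 * N := by
            rw [integral_add (i1.const_mul 2) (hu.integrable_sq.const_mul 2),
              integral_const_mul, integral_const_mul]
        _ ≤ 2 + 2 * N := by linarith
    rw [shiftedEnergy_cylinder hp hχ1 hχ2, hχ5, hχ6]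
    have h1 : (∫ y, p y ^ 2) * (B / T) ≤ τ / 2 :=
      (mul_le_mul_of_nonneg_right hpN (by positivity)).trans hTB
    have h2 : shiftedEnergy c p * (T * A) ≤ τ / 2 := by
      rcases le_total (shiftedEnergy c p) 0 with h | h
      · exact (mul_nonpos_of_nonpos_of_nonneg h (by positivity)).trans (by positivity)
      · nlinarith [mul_nonneg h hk]
    linarith
  · have hslab : MeasurableSet {x : EuclideanSpace ℝ (Fin (d + 1)) | |x (Fin.last d)| ≤ k} :=
      (isClosed_le continuous_axial.abs continuous_const).measurableSet
    calc ∫ x in {x | |x (Fin.last d)| ≤ k},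
          (p (crossProj x) * χ (x (Fin.last d)) - u (crossProj x)) ^ 2
        = ∫ x : EuclideanSpace ℝ (Fin (d + 1)), (fun y => (p y - u y) ^ 2) (crossProj x) *
            (Icc (-k) k).indicator 1 (x (Fin.last d)) := by
          rw [← integral_indicator hslab]
          refine integral_congr_ae (.of_forall fun x => ?_)
          by_cases hx : |x (Fin.last d)| ≤ k
          · simp [hx, hχ4 _ (hx.trans hTk), abs_le.1 hx]
          · have : x (Fin.last d) ∉ Icc (-k) k := fun h => hx (abs_le.2 h)
            simp [hx, this]
      _ = (∫ y, (p y - u y) ^ 2) * (2 * k) := by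
          rw [integral_crossProj_mul (f := fun y => (p y - u y) ^ 2)
            ((hp.continuous.measurable.sub hum).pow_const 2)
            (measurable_one.indicator measurableSet_Icc), integral_indicator_one measurableSet_Icc]
          simp [Measure.real, hk, two_mul]
      _ ≤ τ := by nlinarith [mul_nonneg hpu0 (mul_nonneg hT.le hA)]

/-! ### The logarithmic gradient estimate -/

lemma IsTestFunction.fun_add {n : ℕ} {O : Set (EuclideanSpace ℝ (Fin n))}
    {φ ψ : EuclideanSpace ℝ (Fin n) → ℝ} (hφ : IsTestFunction O φ) (hψ : IsTestFunction O ψ) :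
    IsTestFunction O fun x => φ x + ψ x :=
  ⟨hφ.contDiff.add hψ.contDiff, hφ.hasCompactSupport.add hψ.hasCompactSupport,
    (tsupport_add φ ψ).trans (union_subset hφ.tsupport_subset hψ.tsupport_subset)⟩

/-- The expansion of `‖∇(w + t v)‖²` for `v = η² / (w + ε)`. Here `g = ∇w`, `b = ∇η`,
`r = η / (w + ε)`, and `∇v = r (2 b - r g)`. -/
lemma norm_add_smul_sq_le {F : Type*} [NormedAddCommGroup F] [InnerProductSpace ℝ F] (g b : F)
    {r t : ℝ} (ht : 0 ≤ t) (hr : t * r ^ 2 ≤ 1 / 4) :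
    ‖g + t • r • ((2 : ℝ) • b - r • g)‖ ^ 2 ≤
      ‖g‖ ^ 2 + t * (6 * ‖b‖ ^ 2 - 1 / 2 * ‖r • g‖ ^ 2) := by
  obtain ⟨a, ha⟩ : ∃ a, a = r • g := ⟨_, rfl⟩
  rw [← ha]
  set e := (2 : ℝ) • b - a with he
  have h1 : ‖g + t • r • e‖ ^ 2 = ‖g‖ ^ 2 + 2 * t * inner ℝ a e + t * (t * r ^ 2) * ‖e‖ ^ 2 := by
    rw [norm_add_sq_real, norm_smul, norm_smul, mul_pow, mul_pow, Real.norm_eq_abs, sq_abs,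
      Real.norm_eq_abs, sq_abs, inner_smul_right, inner_smul_right, ha, real_inner_smul_left]
    ring
  have h2 : inner ℝ a e = 2 * inner ℝ a b - ‖a‖ ^ 2 := by
    rw [he, inner_sub_right, inner_smul_right, real_inner_self_eq_norm_sq]
  have h3 : ‖e‖ ^ 2 = 4 * ‖b‖ ^ 2 - 4 * inner ℝ a b + ‖a‖ ^ 2 := by
    rw [he, norm_sub_sq_real, norm_smul, real_inner_smul_left, real_inner_comm]
    norm_num [mul_pow]
    ring
  have h4 : ‖a + (2 : ℝ) • b‖ ^ 2 = ‖a‖ ^ 2 + 4 * inner ℝ a b + 4 * ‖b‖ ^ 2 := by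
    rw [norm_add_sq_real, norm_smul, inner_smul_right]
    norm_num [mul_pow]
    ring
  have h5 : t * (t * r ^ 2) * ‖e‖ ^ 2 ≤ t * (1 / 4) * ‖e‖ ^ 2 := by gcongr
  have h6 : 0 ≤ t * ‖e‖ ^ 2 := by positivity
  have h7 : 0 ≤ t * ‖a + (2 : ℝ) • b‖ ^ 2 := by positivity
  rw [h3] at h5 h6
  rw [h4] at h7
  rw [h1, h2, h3]
  linarith

/-- If the shifted energy is non-negative on `C_c^∞(O)`, then `∇ log (w + ε)` is bounded in
`L²_loc(O)` for all `w ≥ 0` of shifted energy at most `ε²`, uniformly in `w` and `ε`. Minimality is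
tested with the competitor `w + t η² / (w + ε)`, and `t = ε² / (4 M)` absorbs the term of second
order in `t`. -/
theorem IsTestFunction.integral_log_gradient_le {n : ℕ} {O : Set (EuclideanSpace ℝ (Fin n))}
    {c : ℝ} (hc : 0 ≤ c) (hO : ∀ φ, IsTestFunction O φ → 0 ≤ shiftedEnergy c φ)
    {w η : EuclideanSpace ℝ (Fin n) → ℝ} (hw : IsTestFunction O w) (hw0 : ∀ x, 0 ≤ w x)
    (hη : IsTestFunction O η) {M ε : ℝ} (hM : 0 < M) (hηM : ∀ x, η x ^ 2 ≤ M) (hε : 0 < ε) :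
    ∫ x, ‖(η x * (w x + ε)⁻¹) • gradient w x‖ ^ 2 ≤
      12 * (∫ x, ‖gradient η x‖ ^ 2) + 8 * M / ε ^ 2 * shiftedEnergy c w := by
  have hpos (x) : 0 < w x + ε := by have := hw0 x; positivity
  set t := ε ^ 2 / (4 * M) with ht
  have ht0 : 0 < t := by positivity
  have hinv : ContDiff ℝ ∞ fun x => (w x + ε)⁻¹ :=
    (hw.contDiff.add contDiff_const).inv fun x => (hpos x).ne'
  set v := fun x => η x * η x * (w x + ε)⁻¹ with hv
  have hvt : IsTestFunction O v :=
    hη.of_eq_zero ((hη.contDiff.mul hη.contDiff).mul hinv) fun x hx => by simp [hv, hx]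
  have htv : IsTestFunction O fun x => t * v x :=
    hvt.of_eq_zero (contDiff_const.mul hvt.contDiff) fun x hx => by simp [hx]
  have hz := hw.fun_add htv
  have hgrad (x) : gradient (fun x => w x + t * v x) x = gradient w x +
      t • (η x * (w x + ε)⁻¹) •
        ((2 : ℝ) • gradient η x - (η x * (w x + ε)⁻¹) • gradient w x) := by
    have h1 : HasGradientAt (fun x => (w x + ε)⁻¹) _ x :=
      (((hasDerivAt_id (w x)).add_const ε).inv (hpos x).ne').comp_hasGradientAt
        (hw.hasGradientAt x)
    have h2 := (((hη.hasGradientAt x).fun_mul (hη.hasGradientAt x)).fun_mul h1)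
    have h3 := (hw.hasGradientAt x).fun_add ((hasGradientAt_const x t).fun_mul h2)
    refine h3.gradient.trans ?_
    simp only [id, neg_div, one_div, ← inv_pow]
    module
  have i1 : Integrable fun x => ‖gradient η x‖ ^ 2 := hη.integrable_norm_gradient_sq
  have i2 : Integrable fun x => ‖(η x * (w x + ε)⁻¹) • gradient w x‖ ^ 2 :=
    hη.integrable_of_eq_zero (((hη.continuous.mul hinv.continuous).smul
      hw.continuous_gradient).norm.pow 2) fun x hx _ => by simp [hx]
  have i3 : Integrable fun x => 6 * ‖gradient η x‖ ^ 2 -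
      1 / 2 * ‖(η x * (w x + ε)⁻¹) • gradient w x‖ ^ 2 := (i1.const_mul 6).sub (i2.const_mul _)
  have key : 0 ≤ shiftedEnergy c w + t * (6 * (∫ x, ‖gradient η x‖ ^ 2) -
      1 / 2 * ∫ x, ‖(η x * (w x + ε)⁻¹) • gradient w x‖ ^ 2) := by
    calc (0 : ℝ) ≤ shiftedEnergy c fun x => w x + t * v x := hO _ hz
      _ ≤ ∫ x, ((‖gradient w x‖ ^ 2 - c * w x ^ 2) + t * (6 * ‖gradient η x‖ ^ 2 -
            1 / 2 * ‖(η x * (w x + ε)⁻¹) • gradient w x‖ ^ 2)) := by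
          refine integral_mono (hz.integrable_energy c) ((hw.integrable_energy c).add
            (i3.const_mul t)) fun x => ?_
          have hr : t * (η x * (w x + ε)⁻¹) ^ 2 ≤ 1 / 4 := by
            have h1 : ε ^ 2 ≤ (w x + ε) ^ 2 :=
              pow_le_pow_left₀ hε.le (by linarith [hw0 x]) 2
            have h2 := mul_le_mul h1 (hηM x) (sq_nonneg _) (sq_nonneg _)
            have hp := hpos x
            rw [ht, mul_pow, inv_pow, ← div_eq_mul_inv, div_mul_div_comm, div_le_div_iff₀
              (by positivity) (by norm_num)]
            linarith
          have h1 := norm_add_smul_sq_le (gradient w x) (gradient η x) ht0.le hr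
          have hv0 : 0 ≤ t * v x :=
            mul_nonneg ht0.le (mul_nonneg (mul_self_nonneg _) (inv_nonneg.2 (hpos x).le))
          have h2 : c * w x ^ 2 ≤ c * (w x + t * v x) ^ 2 :=
            mul_le_mul_of_nonneg_left (pow_le_pow_left₀ (hw0 x) (by linarith) 2) hc
          simp only [hgrad]
          linarith
      _ = _ := by
          rw [integral_add (hw.integrable_energy c) (i3.const_mul t), integral_const_mul,
            integral_sub (i1.const_mul 6) (i2.const_mul (1 / 2)), integral_const_mul,
            integral_const_mul, shiftedEnergy]
  have ht' : 8 * M / ε ^ 2 * t = 2 := by rw [ht]; field_simp; norm_num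
  have := mul_nonneg (show 0 ≤ 8 * M / ε ^ 2 by positivity) key
  rw [mul_add, ← mul_assoc, ht'] at this
  linarith

/-! ### Logarithms of a minimizing sequence -/

lemma IsTestFunction.exists_sq_le {n : ℕ} {O : Set (EuclideanSpace ℝ (Fin n))}
    {η : EuclideanSpace ℝ (Fin n) → ℝ} (hη : IsTestFunction O η) : ∃ M > 0, ∀ x, η x ^ 2 ≤ M := by
  obtain ⟨C, hC⟩ := hη.hasCompactSupport.exists_bound_of_continuous hη.continuous
  refine ⟨C ^ 2 + 1, by positivity, fun x => ?_⟩
  have := pow_le_pow_left₀ (norm_nonneg _) (hC x) 2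
  rw [Real.norm_eq_abs, sq_abs] at this
  linarith

/-- The pointwise limit of `log (1 + s / ε) / log (1 / ε)` along `ε = exp (-(k + 1))`. -/
lemma tendsto_log_one_add_exp_mul {s : ℝ} (hs : 0 ≤ s) :
    Filter.Tendsto (fun k : ℕ => Real.log (1 + Real.exp (k + 1) * s) / (k + 1)) Filter.atTop
      (nhds (if s = 0 then 0 else 1)) := by
  split_ifs with h
  · simp [h]
  · have hs' : 0 < s := hs.lt_of_ne' h
    have hk : Filter.Tendsto (fun k : ℕ => (k : ℝ) + 1) Filter.atTop Filter.atTop :=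
      Filter.tendsto_atTop_add_const_right _ _ tendsto_natCast_atTop_atTop
    have h1 : Filter.Tendsto (fun k : ℕ => Real.log (Real.exp (-((k : ℝ) + 1)) + s))
        Filter.atTop (nhds (Real.log (0 + s))) :=
      ((Real.tendsto_exp_neg_atTop_nhds_zero.comp hk).add_const s).log (by simpa using h)
    have h2 := (h1.div_atTop hk).const_add 1
    rw [add_zero] at h2
    refine h2.congr fun k => ?_
    have hk0 : (0 : ℝ) < k + 1 := by positivity
    have : 1 + Real.exp (k + 1) * s =
        Real.exp (k + 1) * (Real.exp (-((k : ℝ) + 1)) + s) := by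
      rw [mul_add, ← Real.exp_add, add_neg_cancel, Real.exp_zero]
    rw [this, Real.log_mul (Real.exp_pos _).ne' (by positivity), Real.log_exp]
    field_simp

lemma log_one_add_exp_mul_le {s m : ℝ} (hs : 0 ≤ s) (hm : 1 ≤ m) :
    Real.log (1 + Real.exp m * s) / m ≤ 1 + s := by
  have h1 : 1 + Real.exp m * s ≤ Real.exp m * (1 + s) := by
    have := Real.one_le_exp (by linarith : (0 : ℝ) ≤ m)
    linarith
  have h2 : Real.log (1 + Real.exp m * s) ≤ m + s := by
    refine (Real.log_le_log (by positivity) h1).trans ?_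
    rw [Real.log_mul (Real.exp_pos _).ne' (by positivity), Real.log_exp]
    linarith [Real.log_le_sub_one_of_pos (by positivity : 0 < 1 + s)]
  rw [div_le_iff₀ (by linarith)]
  nlinarith

lemma abs_log_one_add_sub_le {a b : ℝ} (ha : 0 ≤ a) (hb : 0 ≤ b) :
    |Real.log (1 + a) - Real.log (1 + b)| ≤ |a - b| := by
  wlog hab : b ≤ a generalizing a b
  · rw [abs_sub_comm, abs_sub_comm a]
    exact this hb ha (le_of_not_ge hab)
  have h1 : Real.log (1 + b) ≤ Real.log (1 + a) := Real.log_le_log (by positivity) (by linarith)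
  rw [abs_of_nonneg (by linarith), abs_of_nonneg (by linarith), ← Real.log_div (by positivity)
    (by positivity)]
  refine (Real.log_le_sub_one_of_pos (by positivity)).trans ?_
  rw [div_sub_one (by positivity), div_le_iff₀ (by positivity)]
  nlinarith

lemma memLp_crossProj_restrict_slab {d : ℕ} {u : EuclideanSpace ℝ (Fin d) → ℝ}
    (hum : Measurable u) (hu : MemLp u 2) (k : ℝ) :
    MemLp (fun x : EuclideanSpace ℝ (Fin (d + 1)) => u (crossProj x)) 2
      (volume.restrict {x | |x (Fin.last d)| ≤ k}) := by
  have hslab : MeasurableSet {x : EuclideanSpace ℝ (Fin (d + 1)) | |x (Fin.last d)| ≤ k} :=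
    (isClosed_le continuous_axial.abs continuous_const).measurableSet
  refine (memLp_two_iff_integrable_sq
    (hum.comp crossProj.continuous.measurable).aestronglyMeasurable).2 ?_
  have hi : Integrable ((Icc (-k) k).indicator (1 : ℝ → ℝ)) :=
    (integrable_indicator_iff measurableSet_Icc).2 continuous_one.integrableOn_Icc
  have h := measurePreserving_split.integrable_comp_of_integrable
    (hu.integrable_sq.mul_prod hi)
  rw [← IntegrableOn, ← integrable_indicator_iff hslab]
  refine h.congr (.of_forall fun x => ?_)
  by_cases hx : |x (Fin.last d)| ≤ k
  · simp [hx, abs_le.1 hx]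
  · have : x (Fin.last d) ∉ Icc (-k) k := fun h => hx (abs_le.2 h)
    simp [hx, this]

open Filter Topology in
/-- If the shifted energy is non-negative on `C_c^∞(O)`, there are test functions `h` on the
cylinder that converge in `L²_loc` to the indicator of `{u ≠ 0} × ℝ`, while their gradients tend
to zero in `L²_loc(O)`, also near the boundary of the cylinder. They are
`h = log (1 + w / ε) / log (1 / ε)` with `ε = exp (-(k + 1))` and a minimizing `w ≈ u`. -/
theorem exists_log_sequence {d : ℕ} {Q : Set (EuclideanSpace ℝ (Fin d))}
    {O : Set (EuclideanSpace ℝ (Fin (d + 1)))} (hQO : cylinderOver Q ⊆ O) {c : ℝ} (hc : 0 ≤ c)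
    (hO : ∀ φ, IsTestFunction O φ → 0 ≤ shiftedEnergy c φ)
    {u : EuclideanSpace ℝ (Fin d) → ℝ} (hum : Measurable u) (hu0 : ∀ x, 0 ≤ u x) (hu : MemLp u 2)
    (happ : ∀ τ > 0, ∃ p, IsTestFunction Q p ∧ (∀ x, 0 ≤ p x) ∧
      ∫ x, (p x - u x) ^ 2 ≤ τ ∧ shiftedEnergy c p ≤ τ) :
    ∃ h : ℕ → EuclideanSpace ℝ (Fin (d + 1)) → ℝ, (∀ k, IsTestFunction (cylinderOver Q) (h k)) ∧
      (∀ η, IsTestFunction O η →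
        Tendsto (fun k => ∫ x, ‖η x • gradient (h k) x‖ ^ 2) atTop (𝓝 0)) ∧
      ∀ S, IsCompact S → Tendsto
        (fun k => ∫ x in S, (h k x - if u (crossProj x) = 0 then 0 else 1) ^ 2) atTop (𝓝 0) := by
  have hm0 (k : ℕ) : (0 : ℝ) < (k : ℝ) + 1 := by positivity
  choose w hw hw0 hwE hwu using fun k : ℕ => exists_cylinder_minimizer hum hu happ
    (τ := Real.exp (-((k : ℝ) + 1)) ^ 2) (by positivity) (hm0 k).le
  have hpos (k : ℕ) (x) : 0 < 1 + Real.exp ((k : ℝ) + 1) * w k x := by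
    have := hw0 k x; positivity
  have hinv2 : Tendsto (fun k : ℕ => (((k : ℝ) + 1) ^ 2)⁻¹) atTop (𝓝 0) := by
    have := (tendsto_one_div_add_atTop_nhds_zero_nat (𝕜 := ℝ)).pow 2
    simpa using this
  set h : ℕ → EuclideanSpace ℝ (Fin (d + 1)) → ℝ :=
    fun k x => Real.log (1 + Real.exp ((k : ℝ) + 1) * w k x) / (k + 1) with hh
  have hht (k) : IsTestFunction (cylinderOver Q) (h k) :=
    (hw k).of_eq_zero (((contDiff_const.add (contDiff_const.mul (hw k).contDiff)).log
      fun x => (hpos k x).ne').div_const _) fun x hx => by simp [hh, hx]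
  refine ⟨h, hht, fun η hη => ?_, fun S hS => ?_⟩
  · obtain ⟨M, hM, hηM⟩ := hη.exists_sq_le
    set B := ∫ x, ‖gradient η x‖ ^ 2
    have hlim := hinv2.const_mul (12 * B + 8 * M)
    rw [mul_zero] at hlim
    refine squeeze_zero (fun k => integral_nonneg fun x => sq_nonneg _) (fun k => ?_) hlim
    set ε := Real.exp (-((k : ℝ) + 1)) with hε
    have hε0 : 0 < ε := Real.exp_pos _
    have hest := ((hw k).mono hQO).integral_log_gradient_le hc hO (hw0 k) hη hM hηM hε0
    have hE : 8 * M / ε ^ 2 * shiftedEnergy c (w k) ≤ 8 * M := by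
      refine (mul_le_mul_of_nonneg_left (hwE k) (by positivity)).trans_eq ?_
      rw [← hε]
      field_simp
    have hgrad (x) : ‖η x • gradient (h k) x‖ ^ 2 =
        (((k : ℝ) + 1) ^ 2)⁻¹ * ‖(η x * (w k x + ε)⁻¹) • gradient (w k) x‖ ^ 2 := by
      have h1 : HasDerivAt (fun s : ℝ => Real.log (1 + Real.exp ((k : ℝ) + 1) * s) / (k + 1))
          _ (w k x) :=
        ((((hasDerivAt_id (w k x)).const_mul (Real.exp ((k : ℝ) + 1))).const_add 1).log
          (hpos k x).ne').div_const _
      have h2 : gradient (h k) x = (((k : ℝ) + 1)⁻¹ * (w k x + ε)⁻¹) • gradient (w k) x := by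
        refine (h1.comp_hasGradientAt ((hw k).hasGradientAt x)).gradient.trans ?_
        congr 1
        have e1 : w k x + ε = ε * (1 + Real.exp ((k : ℝ) + 1) * w k x) := by
          rw [mul_add, ← mul_assoc, hε, ← Real.exp_add, neg_add_cancel, Real.exp_zero]
          ring
        have e2 : Real.exp ((k : ℝ) + 1) = ε⁻¹ := by rw [hε, Real.exp_neg, inv_inv]
        have := hpos k x
        rw [e1, id, mul_one]
        rw [e2] at this ⊢
        have := hm0 k
        field_simp
      rw [h2, smul_smul, norm_smul, norm_smul, mul_pow, mul_pow, Real.norm_eq_abs, sq_abs,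
        Real.norm_eq_abs, sq_abs]
      generalize (k : ℝ) + 1 = m
      ring
    simp_rw [hgrad, integral_const_mul]
    rw [mul_comm]
    exact mul_le_mul_of_nonneg_right (by linarith) (by positivity)
  · set H : ℕ → EuclideanSpace ℝ (Fin (d + 1)) → ℝ :=
      fun k x => Real.log (1 + Real.exp ((k : ℝ) + 1) * u (crossProj x)) / (k + 1) with hH
    set Z : EuclideanSpace ℝ (Fin (d + 1)) → ℝ := fun x => if u (crossProj x) = 0 then 0 else 1
    have hucm : Measurable fun x : EuclideanSpace ℝ (Fin (d + 1)) => u (crossProj x) :=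
      hum.comp crossProj.continuous.measurable
    have hZm : Measurable Z :=
      Measurable.ite (hucm (measurableSet_singleton 0)) measurable_const measurable_const
    have hHm (k) : Measurable (H k) := by fun_prop
    obtain ⟨k₀, hk₀⟩ : ∃ k₀ : ℕ, ∀ k ≥ k₀, S ⊆ {x | |x (Fin.last d)| ≤ (k : ℝ) + 1} := by
      obtain ⟨C, hC⟩ := hS.exists_bound_of_continuousOn
        (continuous_axial (d := d)).continuousOn
      obtain ⟨k₀, hk₀⟩ := exists_nat_ge C
      refine ⟨k₀, fun k hk x hx => (hC x hx).trans (hk₀.trans ?_)⟩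
      have : (k₀ : ℝ) ≤ k := by exact_mod_cast hk
      linarith
    have huS : MemLp (fun x => u (crossProj x)) 2 (volume.restrict S) :=
      (memLp_crossProj_restrict_slab hum hu _).mono_measure
        (Measure.restrict_mono (hk₀ k₀ le_rfl) le_rfl)
    have : IsFiniteMeasure (volume.restrict S) := ⟨by
      rw [Measure.restrict_apply_univ]; exact hS.measure_lt_top⟩
    have hbound (k x) : (H k x - Z x) ^ 2 ≤ 2 + 2 * u (crossProj x) ^ 2 := by
      have h0 := hu0 (crossProj x)
      have h1 : H k x ≤ 1 + u (crossProj x) :=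
        log_one_add_exp_mul_le h0 (by linarith [(Nat.cast_nonneg k : (0 : ℝ) ≤ k)])
      have h2 : 0 ≤ H k x := div_nonneg (Real.log_nonneg (by
        have := mul_nonneg (Real.exp_pos ((k : ℝ) + 1)).le h0; linarith)) (hm0 k).le
      have h3 : 0 ≤ Z x ∧ Z x ≤ 1 := by simp only [Z]; split_ifs <;> simp
      have h4 : (H k x - Z x) ^ 2 ≤ (1 + u (crossProj x)) ^ 2 :=
        sq_le_sq' (by linarith) (by linarith)
      nlinarith [sq_nonneg (1 - u (crossProj x))]
    have hbi : Integrable (fun x => 2 + 2 * u (crossProj x) ^ 2) (volume.restrict S) :=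
      (integrable_const 2).add (huS.integrable_sq.const_mul 2)
    have iHZ (k) : Integrable (fun x => (H k x - Z x) ^ 2) (volume.restrict S) :=
      hbi.mono' (((hHm k).sub hZm).pow_const 2).aestronglyMeasurable
        (.of_forall fun x => by
          rw [Real.norm_eq_abs, abs_of_nonneg (sq_nonneg _)]; exact hbound k x)
    have lim1 : Tendsto (fun k => ∫ x in S, (H k x - Z x) ^ 2) atTop (𝓝 0) := by
      have := tendsto_integral_of_dominated_convergence (μ := volume.restrict S)
        (F := fun k x => (H k x - Z x) ^ 2) (f := fun _ => 0) _
        (fun k => (((hHm k).sub hZm).pow_const 2).aestronglyMeasurable) hbi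
        (fun k => .of_forall fun x => by
          rw [Real.norm_eq_abs, abs_of_nonneg (sq_nonneg _)]; exact hbound k x)
        (.of_forall fun x => by
          have := ((tendsto_log_one_add_exp_mul (hu0 (crossProj x))).sub_const (Z x)).pow 2
          simpa [Z] using this)
      simpa using this
    have hdiff (k x) : (h k x - H k x) ^ 2 ≤ (((k : ℝ) + 1) ^ 2)⁻¹ *
        (Real.exp ((k : ℝ) + 1) ^ 2 * (w k x - u (crossProj x)) ^ 2) := by
      have e := abs_log_one_add_sub_le (mul_nonneg (Real.exp_pos ((k : ℝ) + 1)).le (hw0 k x))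
        (mul_nonneg (Real.exp_pos ((k : ℝ) + 1)).le (hu0 (crossProj x)))
      simp only [hh, hH]
      rw [← sub_div, div_pow, div_eq_inv_mul, ← mul_pow, mul_sub]
      exact mul_le_mul_of_nonneg_left (sq_le_sq.2 e) (by positivity)
    have iwu (k) : Integrable (fun x => (w k x - u (crossProj x)) ^ 2)
        (volume.restrict {x | |x (Fin.last d)| ≤ (k : ℝ) + 1}) :=
      (((hw k).memLp_two.restrict _).sub (memLp_crossProj_restrict_slab hum hu _)).integrable_sq
    have iwuS (k) : Integrable (fun x => (w k x - u (crossProj x)) ^ 2) (volume.restrict S) :=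
      (((hw k).memLp_two.restrict _).sub huS).integrable_sq
    have ihH (k) : Integrable (fun x => (h k x - H k x) ^ 2) (volume.restrict S) :=
      (((iwuS k).const_mul _).const_mul _).mono'
        (((hht k).continuous.measurable.sub (hHm k)).pow_const 2).aestronglyMeasurable
        (.of_forall fun x => by
          rw [Real.norm_eq_abs, abs_of_nonneg (sq_nonneg _)]; exact hdiff k x)
    have hsum := (hinv2.const_mul 2).add (lim1.const_mul 2)
    simp only [mul_zero, add_zero] at hsum
    refine squeeze_zero' (.of_forall fun k => integral_nonneg fun x => sq_nonneg _) ?_ hsum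
    filter_upwards [eventually_ge_atTop k₀] with k hk
    have e1 : ∫ x in S, (h k x - H k x) ^ 2 ≤ (((k : ℝ) + 1) ^ 2)⁻¹ := by
      calc ∫ x in S, (h k x - H k x) ^ 2
          ≤ ∫ x in S, (((k : ℝ) + 1) ^ 2)⁻¹ *
              (Real.exp ((k : ℝ) + 1) ^ 2 * (w k x - u (crossProj x)) ^ 2) :=
            integral_mono (ihH k) (((iwuS k).const_mul _).const_mul _) (hdiff k)
        _ = (((k : ℝ) + 1) ^ 2)⁻¹ * (Real.exp ((k : ℝ) + 1) ^ 2 *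
              ∫ x in S, (w k x - u (crossProj x)) ^ 2) := by
            rw [integral_const_mul, integral_const_mul]
        _ ≤ (((k : ℝ) + 1) ^ 2)⁻¹ * (Real.exp ((k : ℝ) + 1) ^ 2 *
              Real.exp (-((k : ℝ) + 1)) ^ 2) := by
            refine mul_le_mul_of_nonneg_left (mul_le_mul_of_nonneg_left ?_ (by positivity))
              (by positivity)
            exact (setIntegral_mono_set (iwu k) (.of_forall fun x => sq_nonneg _)
              (hk₀ k hk).eventuallyLE).trans (hwu k)
        _ = (((k : ℝ) + 1) ^ 2)⁻¹ := by
            rw [← mul_pow, ← Real.exp_add, add_neg_cancel, Real.exp_zero, one_pow, mul_one]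
    calc ∫ x in S, (h k x - Z x) ^ 2
        ≤ ∫ x in S, (2 * (h k x - H k x) ^ 2 + 2 * (H k x - Z x) ^ 2) := by
          refine integral_mono_of_nonneg (.of_forall fun x => sq_nonneg _)
            (((ihH k).const_mul 2).add ((iHZ k).const_mul 2)) (.of_forall fun x => ?_)
          change (h k x - Z x) ^ 2 ≤ 2 * (h k x - H k x) ^ 2 + 2 * (H k x - Z x) ^ 2
          nlinarith [sq_nonneg ((h k x - H k x) - (H k x - Z x))]
      _ = 2 * (∫ x in S, (h k x - H k x) ^ 2) + 2 * ∫ x in S, (H k x - Z x) ^ 2 := by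
          rw [integral_add ((ihH k).const_mul 2) ((iHZ k).const_mul 2), integral_const_mul,
            integral_const_mul]
      _ ≤ _ := by linarith

/-! ### Functions with vanishing weak gradient on a domain -/

section Constancy

open Filter Topology Metric

variable {n : ℕ} {O : Set (EuclideanSpace ℝ (Fin n))} {f : EuclideanSpace ℝ (Fin n) → ℝ}

/-- The reflected and translated bumps against which a mollification at `y` integrates. -/
lemma isTestFunction_bump_sub {φ : ContDiffBump (0 : EuclideanSpace ℝ (Fin n))}
    {y : EuclideanSpace ℝ (Fin n)} (hy : closedBall y φ.rOut ⊆ O) :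
    IsTestFunction O fun t => φ.normed volume (y - t) := by
  have hs : (Function.support fun t => φ.normed volume (y - t)) ⊆ closedBall y φ.rOut := by
    intro t ht
    have : y - t ∈ tsupport (φ.normed volume) := subset_tsupport _ ht
    rw [φ.tsupport_normed_eq, mem_closedBall_zero_iff] at this
    rwa [mem_closedBall, dist_comm, dist_eq_norm]
  exact ⟨φ.contDiff_normed.comp (contDiff_const.sub contDiff_id),
    HasCompactSupport.of_support_subset_isCompact (isCompact_closedBall _ _) hs,
    (closure_minimal hs isClosed_closedBall).trans hy⟩

/-- The mollifications of a function with vanishing weak gradient have vanishing gradient. -/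
lemma hasFDerivAt_mollification (hf : LocallyIntegrable f)
    (hzero : ∀ ψ, IsTestFunction O ψ → ∀ v, ∫ x, fderiv ℝ ψ x v * f x = 0)
    {φ : ContDiffBump (0 : EuclideanSpace ℝ (Fin n))} {y : EuclideanSpace ℝ (Fin n)}
    (hy : closedBall y φ.rOut ⊆ O) :
    HasFDerivAt (convolution (φ.normed volume) f (ContinuousLinearMap.lsmul ℝ ℝ) volume)
      (0 : EuclideanSpace ℝ (Fin n) →L[ℝ] ℝ) y := by
  set L := ContinuousLinearMap.lsmul ℝ ℝ (E := ℝ) with hL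
  have hflip : convolution (φ.normed volume) f L volume =
      convolution f (φ.normed volume) L.flip volume :=
    convolution_flip (f := f) (g := φ.normed volume) L.flip
  have hc : HasCompactSupport (φ.normed volume) := φ.hasCompactSupport_normed
  have hd : ContDiff ℝ 1 (φ.normed volume) := φ.contDiff_normed
  rw [hflip]
  refine (hc.hasFDerivAt_convolution_right L.flip hf hd y).congr_fderiv
    (ContinuousLinearMap.ext fun v => ?_)
  rw [convolution_precompR_apply L.flip hf (hc.fderiv ℝ) (hd.continuous_fderiv one_ne_zero)]
  have h1 := hzero _ (isTestFunction_bump_sub hy) v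
  have h2 (t) : fderiv ℝ (fun t => φ.normed volume (y - t)) t v =
      -(fderiv ℝ (φ.normed volume) (y - t) v) := by
    have := ((hd.differentiable one_ne_zero (y - t)).hasFDerivAt).comp t
      ((hasFDerivAt_id t).const_sub y)
    rw [show fderiv ℝ (fun t => φ.normed volume (y - t)) t = _ from this.fderiv]
    simp
  simp_rw [h2, neg_mul, integral_neg, neg_eq_zero] at h1
  rw [convolution_def]
  simpa [hL] using h1

/-- The mollifications are constant on the ball, and they converge to `f` almost everywhere. -/
lemma exists_ae_eq_const_ball (hf : LocallyIntegrable f)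
    (hzero : ∀ ψ, IsTestFunction O ψ → ∀ v, ∫ x, fderiv ℝ ψ x v * f x = 0)
    {x₀ : EuclideanSpace ℝ (Fin n)} {r : ℝ} (hr : 0 < r) (hrO : ball x₀ (2 * r) ⊆ O) :
    ∃ c, ∀ᵐ y, y ∈ ball x₀ r → f y = c := by
  let φ : ℕ → ContDiffBump (0 : EuclideanSpace ℝ (Fin n)) := fun k =>
    ⟨r / (k + 2) / 2, r / (k + 2), by positivity, half_lt_self (by positivity)⟩
  have hφr (k) : (φ k).rOut < r := div_lt_self hr (by
    have : (0 : ℝ) ≤ k := Nat.cast_nonneg k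
    linarith)
  have hlim : Tendsto (fun k => (φ k).rOut) atTop (𝓝 0) :=
    tendsto_const_nhds.div_atTop
      (tendsto_atTop_add_const_right _ _ tendsto_natCast_atTop_atTop)
  have hae := ContDiffBump.ae_convolution_tendsto_right_of_locallyIntegrable (φ := φ)
    (l := atTop) (K := 2) (μ := volume) hlim
    (.of_forall fun k => (by change _ ≤ 2 * (r / (k + 2) / 2); linarith [le_refl (φ k).rOut,
      show (φ k).rOut = r / (k + 2) from rfl])) hf
  have hd (k) (y) (hy : y ∈ ball x₀ r) := hasFDerivAt_mollification hf hzero (φ := φ k) (y := y)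
    ((closedBall_subset_ball' (by have := hφr k; have := mem_ball.1 hy; linarith)).trans hrO)
  have hconst (k) {y z} (hy : y ∈ ball x₀ r) (hz : z ∈ ball x₀ r) :=
    isOpen_ball.is_const_of_fderiv_eq_zero (convex_ball x₀ r).isPreconnected
      (fun y hy => (hd k y hy).differentiableAt.differentiableWithinAt)
      (fun y hy => (hd k y hy).fderiv) hy hz
  have hpos : volume (ball x₀ r) ≠ 0 := (measure_ball_pos volume x₀ hr).ne'
  obtain ⟨z, hz, hzlim⟩ : ∃ z ∈ ball x₀ r, Tendsto (fun k => convolution ((φ k).normed volume) f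
      (ContinuousLinearMap.lsmul ℝ ℝ) volume z) atTop (𝓝 (f z)) := by
    by_contra! h
    exact hpos (measure_mono_null (fun z hz => h z hz) hae)
  refine ⟨f z, ?_⟩
  filter_upwards [hae] with y hylim hy
  exact tendsto_nhds_unique hylim (hzlim.congr fun k => (hconst k hy hz).symm)

/-- The sets on which `f` is locally equal to a given constant form an open partition of `O`. -/
theorem ae_eq_const_of_isPreconnected (hO : IsOpen O) (hOc : IsPreconnected O)
    (hf : LocallyIntegrable f)
    (hzero : ∀ ψ, IsTestFunction O ψ → ∀ v, ∫ x, fderiv ℝ ψ x v * f x = 0) :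
    ∃ c, ∀ᵐ y, y ∈ O → f y = c := by
  rcases O.eq_empty_or_nonempty with rfl | ⟨x₀, hx₀⟩
  · exact ⟨0, by simp⟩
  let U (c : ℝ) : Set (EuclideanSpace ℝ (Fin n)) :=
    {x | ∃ r > 0, ∀ᵐ y, y ∈ ball x r → f y = c}
  have hU (c) : IsOpen (U c) := by
    refine Metric.isOpen_iff.2 fun x ⟨r, hr, h⟩ => ⟨r, hr, fun x' hx' => ⟨r - dist x' x,
      sub_pos.2 (mem_ball.1 hx'), ?_⟩⟩
    filter_upwards [h] with y hy hy'
    exact hy (ball_subset_ball' (by linarith) hy')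
  have hloc : ∀ x ∈ O, ∃ c, x ∈ U c := fun x hx => by
    obtain ⟨r, hr, h⟩ := Metric.isOpen_iff.1 hO x hx
    obtain ⟨c, hc⟩ := exists_ae_eq_const_ball hf hzero (half_pos hr)
      (by rwa [mul_div_cancel₀ _ two_ne_zero])
    exact ⟨c, r / 2, half_pos hr, hc⟩
  have huniq {x c c'} (h : x ∈ U c) (h' : x ∈ U c') : c = c' := by
    obtain ⟨r, hr, h⟩ := h
    obtain ⟨r', hr', h'⟩ := h'
    by_contra hne
    refine (measure_ball_pos volume x (lt_min hr hr')).ne'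
      (measure_mono_null (fun y hy => ?_) (h.and h'))
    exact fun hyy => hne ((hyy.1 (ball_subset_ball (min_le_left _ _) hy)).symm.trans
      (hyy.2 (ball_subset_ball (min_le_right _ _) hy)))
  obtain ⟨c, hc⟩ := hloc x₀ hx₀
  refine ⟨c, ?_⟩
  have hsub : O ⊆ U c := by
    refine hOc.subset_left_of_subset_union (hU c)
      (isOpen_biUnion (s := {c' | c' ≠ c}) fun c' _ => hU c') ?_ (fun x hx => ?_) ⟨x₀, hx₀, hc⟩
    · refine disjoint_left.2 fun x hx hx' => ?_
      obtain ⟨c', hc', hx'⟩ := mem_iUnion₂.1 hx'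
      exact hc' (huniq hx' hx)
    · obtain ⟨c', hc'⟩ := hloc x hx
      by_cases h : c' = c
      · exact Or.inl (h ▸ hc')
      · exact Or.inr (mem_iUnion₂.2 ⟨c', h, hc'⟩)
  refine measure_null_of_locally_null {y | ¬(y ∈ O → f y = c)} fun x hx => ?_
  obtain ⟨r, hr, h⟩ := hsub (Classical.not_imp.1 hx).1
  refine ⟨{y | ¬(y ∈ O → f y = c)} ∩ ball x r,
    inter_mem_nhdsWithin _ (ball_mem_nhds x hr), measure_mono_null (fun y hy => ?_) h⟩
  exact fun h => (Classical.not_imp.1 hy.1).2 (h hy.2)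

end Constancy

/-! ### Passing to the limit -/

lemma sq_integral_mul_le {α : Type*} [MeasurableSpace α] {μ : Measure α} {f g : α → ℝ}
    (hf : MemLp f 2 μ) (hg : MemLp g 2 μ) :
    (∫ x, f x * g x ∂μ) ^ 2 ≤ (∫ x, f x ^ 2 ∂μ) * ∫ x, g x ^ 2 ∂μ := by
  have hfg : Integrable (fun x => f x * g x) μ := hf.integrable_mul hg
  have h2 (t : ℝ) : Integrable (fun x => t * t * f x ^ 2 + 2 * t * (f x * g x)) μ :=
    (hf.integrable_sq.const_mul _).add (hfg.const_mul _)
  have h (t : ℝ) : 0 ≤ (∫ x, f x ^ 2 ∂μ) * (t * t) + 2 * (∫ x, f x * g x ∂μ) * t +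
      ∫ x, g x ^ 2 ∂μ := by
    have e : ∫ x, (t * f x + g x) ^ 2 ∂μ = (t * t) * (∫ x, f x ^ 2 ∂μ) +
        2 * t * (∫ x, f x * g x ∂μ) + ∫ x, g x ^ 2 ∂μ := by
      rw [← integral_const_mul, ← integral_const_mul,
        ← integral_add (hf.integrable_sq.const_mul _) (hfg.const_mul _),
        ← integral_add (h2 t) hg.integrable_sq]
      congr 1
      ext x
      ring
    have h0 : 0 ≤ ∫ x, (t * f x + g x) ^ 2 ∂μ := integral_nonneg fun x => sq_nonneg _
    rw [e] at h0
    linarith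
  have := discrim_le_zero h
  rw [discrim] at this
  linarith

section Limit

open Filter Topology

variable {n : ℕ} {O O' : Set (EuclideanSpace ℝ (Fin n))}
  {h : ℕ → EuclideanSpace ℝ (Fin n) → ℝ} {Z : EuclideanSpace ℝ (Fin n) → ℝ}

/-- The `L²_loc` limit of functions whose gradients tend to zero in `L²_loc(O)` has vanishing weak
gradient in `O`. -/
theorem integral_fderiv_mul_limit_eq_zero (hh : ∀ k, IsTestFunction O' (h k))
    (hZ : ∀ S, IsCompact S → MemLp Z 2 (volume.restrict S))
    (hgrad : ∀ η, IsTestFunction O η →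
      Tendsto (fun k => ∫ x, ‖η x • gradient (h k) x‖ ^ 2) atTop (𝓝 0))
    (hlim : ∀ S, IsCompact S → Tendsto (fun k => ∫ x in S, (h k x - Z x) ^ 2) atTop (𝓝 0))
    {ψ : EuclideanSpace ℝ (Fin n) → ℝ} (hψ : IsTestFunction O ψ) (v : EuclideanSpace ℝ (Fin n)) :
    ∫ x, fderiv ℝ ψ x v * Z x = 0 := by
  set S := tsupport ψ
  have hS : IsCompact S := hψ.hasCompactSupport
  have : IsFiniteMeasure (volume.restrict S) := ⟨by
    rw [Measure.restrict_apply_univ]; exact hS.measure_lt_top⟩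
  have hcd : Continuous fun x => fderiv ℝ ψ x v :=
    (hψ.contDiff.continuous_fderiv (by simp)).clm_apply continuous_const
  have hψ0 {x} (hx : x ∉ S) : ψ x = 0 := image_eq_zero_of_notMem_tsupport hx
  have hd0 {x} (hx : x ∉ S) : fderiv ℝ ψ x = 0 := fderiv_of_notMem_tsupport ℝ hx
  have hdc : HasCompactSupport fun x => fderiv ℝ ψ x v :=
    HasCompactSupport.intro hS fun x hx => by simp [hd0 hx]
  have hdL : MemLp (fun x => fderiv ℝ ψ x v) 2 (volume.restrict S) :=
    (hcd.memLp_of_hasCompactSupport hdc).restrict S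
  have hhL (k) : MemLp (fun x => h k x) 2 (volume.restrict S) := (hh k).memLp_two.restrict S
  -- integration by parts for the smooth functions `h k`
  have hparts (k) : ∫ x in S, fderiv ℝ ψ x v * h k x =
      -∫ x in S, 1 * inner ℝ (ψ x • gradient (h k) x) v := by
    have hdh : Continuous fun x => fderiv ℝ (h k) x v :=
      ((hh k).contDiff.continuous_fderiv (by simp)).clm_apply continuous_const
    have e := integral_mul_fderiv_eq_neg_fderiv_mul_of_integrable (μ := volume) (v := v)
      (f := h k) (g := ψ)
      ((hdh.mul hψ.continuous).integrable_of_hasCompactSupport hψ.hasCompactSupport.mul_left)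
      (((hh k).continuous.mul hcd).integrable_of_hasCompactSupport hdc.mul_left)
      (((hh k).continuous.mul hψ.continuous).integrable_of_hasCompactSupport
        hψ.hasCompactSupport.mul_left)
      (fun x _ => (hh k).contDiff.differentiable (by simp) x)
      (fun x _ => hψ.contDiff.differentiable (by simp) x)
    rw [setIntegral_eq_integral_of_forall_compl_eq_zero fun x hx => by simp [hd0 hx],
      setIntegral_eq_integral_of_forall_compl_eq_zero fun x hx => by simp [hψ0 hx]]
    refine Eq.trans ?_ (e.trans ?_)
    · exact integral_congr_ae (.of_forall fun x => mul_comm _ _)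
    · refine congrArg Neg.neg (integral_congr_ae (.of_forall fun x => ?_))
      simp only
      rw [one_mul, real_inner_smul_left, inner_gradient_left, mul_comm]
  have hgc (k) : Continuous fun x => ψ x • gradient (h k) x :=
    hψ.continuous.smul (hh k).continuous_gradient
  have hgs (k) : HasCompactSupport fun x => ψ x • gradient (h k) x :=
    hψ.hasCompactSupport.smul_right
  have hA (k) : (∫ x in S, fderiv ℝ ψ x v * h k x) ^ 2 ≤
      (volume.real S * ‖v‖ ^ 2) * ∫ x, ‖ψ x • gradient (h k) x‖ ^ 2 := by
    have hi : Continuous fun x => inner ℝ (ψ x • gradient (h k) x) v :=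
      (hgc k).inner continuous_const
    have his : HasCompactSupport fun x => inner ℝ (ψ x • gradient (h k) x) v :=
      HasCompactSupport.intro hS fun x hx => by simp [hψ0 hx]
    have hgi : Integrable fun x => ‖ψ x • gradient (h k) x‖ ^ 2 :=
      ((hgc k).memLp_of_hasCompactSupport (hgs k) (p := 2)).integrable_norm_pow (by simp)
    have e := sq_integral_mul_le (μ := volume.restrict S) (f := fun _ => (1 : ℝ))
      (memLp_const 1) ((hi.memLp_of_hasCompactSupport his (p := 2)).restrict S)
    rw [hparts, neg_sq]
    refine e.trans ?_
    have e1 : ∫ _ in S, (1 : ℝ) ^ 2 = volume.real S := by simp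
    rw [e1, mul_assoc]
    refine mul_le_mul_of_nonneg_left ?_ measureReal_nonneg
    calc ∫ x in S, inner ℝ (ψ x • gradient (h k) x) v ^ 2
        ≤ ∫ x in S, ‖v‖ ^ 2 * ‖ψ x • gradient (h k) x‖ ^ 2 := by
          refine integral_mono_of_nonneg (.of_forall fun x => sq_nonneg _)
            ((hgi.restrict).const_mul _) (.of_forall fun x => ?_)
          have := pow_le_pow_left₀ (abs_nonneg _)
            (abs_real_inner_le_norm (ψ x • gradient (h k) x) v) 2
          rw [sq_abs] at this
          change inner ℝ (ψ x • gradient (h k) x) v ^ 2 ≤ _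
          linarith [mul_pow ‖ψ x • gradient (h k) x‖ ‖v‖ 2]
      _ = ‖v‖ ^ 2 * ∫ x, ‖ψ x • gradient (h k) x‖ ^ 2 := by
          rw [integral_const_mul,
            setIntegral_eq_integral_of_forall_compl_eq_zero fun x hx => by simp [hψ0 hx]]
  have hB (k) : (∫ x in S, fderiv ℝ ψ x v * (h k x - Z x)) ^ 2 ≤
      (∫ x in S, fderiv ℝ ψ x v ^ 2) * ∫ x in S, (h k x - Z x) ^ 2 :=
    sq_integral_mul_le hdL ((hhL k).sub (hZ S hS))
  have hlim1 : Tendsto (fun k => (∫ x in S, fderiv ℝ ψ x v * h k x) ^ 2) atTop (𝓝 0) :=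
    squeeze_zero (fun k => sq_nonneg _) hA (by simpa using (hgrad ψ hψ).const_mul _)
  have hlim2 : Tendsto (fun k => (∫ x in S, fderiv ℝ ψ x v * (h k x - Z x)) ^ 2) atTop (𝓝 0) :=
    squeeze_zero (fun k => sq_nonneg _) hB (by simpa using (hlim S hS).const_mul _)
  rw [← setIntegral_eq_integral_of_forall_compl_eq_zero (s := S) fun x hx => by simp [hd0 hx]]
  have hsplit (k) : ∫ x in S, fderiv ℝ ψ x v * Z x = (∫ x in S, fderiv ℝ ψ x v * h k x) -
      ∫ x in S, fderiv ℝ ψ x v * (h k x - Z x) := by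
    have i1 : IntegrableOn (fun x => fderiv ℝ ψ x v * h k x) S := hdL.integrable_mul (hhL k)
    have i2 : IntegrableOn (fun x => fderiv ℝ ψ x v * (h k x - Z x)) S :=
      hdL.integrable_mul ((hhL k).sub (hZ S hS))
    rw [← integral_sub i1 i2]
    congr 1
    ext x
    ring
  have hle (k) : (∫ x in S, fderiv ℝ ψ x v * Z x) ^ 2 ≤
      2 * (∫ x in S, fderiv ℝ ψ x v * h k x) ^ 2 +
        2 * (∫ x in S, fderiv ℝ ψ x v * (h k x - Z x)) ^ 2 := by
    rw [hsplit k]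
    nlinarith [sq_nonneg ((∫ x in S, fderiv ℝ ψ x v * h k x) +
      ∫ x in S, fderiv ℝ ψ x v * (h k x - Z x))]
  have h0 := ge_of_tendsto' ((hlim1.const_mul 2).add (hlim2.const_mul 2)) hle
  simp only [mul_zero, add_zero] at h0
  exact pow_eq_zero_iff two_ne_zero |>.1 (le_antisymm h0 (sq_nonneg _))

lemma exists_isTestFunction_eq_one {K : Set (EuclideanSpace ℝ (Fin n))} (hK : IsCompact K)
    (hO : IsOpen O) (hKO : K ⊆ O) : ∃ η, IsTestFunction O η ∧ ∀ x ∈ K, η x = 1 := by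
  obtain ⟨L, hL, hKL, hLO⟩ := exists_compact_between hK hO hKO
  obtain ⟨η, hη, -, h0, h1⟩ := exists_contMDiff_zero_iff_one_iff_of_isClosed
    (modelWithCornersSelf ℝ (EuclideanSpace ℝ (Fin n))) (n := ⊤)
    isOpen_interior.isClosed_compl hK.isClosed (disjoint_compl_left_iff_subset.2 hKL)
  have hs : Function.support η ⊆ L := fun x hx => by
    by_contra hxL
    exact hx ((h0 x).1 fun h => hxL (interior_subset h))
  exact ⟨η, ⟨contMDiff_iff_contDiff.1 hη, HasCompactSupport.of_support_subset_isCompact hL hs,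
    (closure_minimal hs hL.isClosed).trans hLO⟩, fun x hx => (h1 x).1 hx⟩

lemma sobolevCapacity_le {K : Set (EuclideanSpace ℝ (Fin n))}
    {φ : EuclideanSpace ℝ (Fin n) → ℝ} (hφ : IsTestFunction univ φ) (hK : ∀ x ∈ K, 1 ≤ φ x) :
    sobolevCapacity K ≤ ∫ x, (φ x ^ 2 + ‖gradient φ x‖ ^ 2) := by
  refine csInf_le ⟨0, ?_⟩ ⟨φ, hφ, hK, rfl⟩
  rintro _ ⟨ψ, -, -, rfl⟩
  exact integral_nonneg fun x => by positivity

/-- If test functions on `O'` tend to `1` in `H¹_loc(O)`, the compact subsets of `O` on which they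
vanish have capacity zero: `η (1 - h k)` with a cut-off `η` is admissible for the capacity. -/
theorem sobolevCapacity_nonpos (hO : IsOpen O) (hh : ∀ k, IsTestFunction O' (h k))
    (hgrad : ∀ η, IsTestFunction O η →
      Tendsto (fun k => ∫ x, ‖η x • gradient (h k) x‖ ^ 2) atTop (𝓝 0))
    (hlim : ∀ S ⊆ O, IsCompact S → Tendsto (fun k => ∫ x in S, (h k x - 1) ^ 2) atTop (𝓝 0))
    {K : Set (EuclideanSpace ℝ (Fin n))} (hK : IsCompact K) (hKO : K ⊆ O \ O') :
    sobolevCapacity K ≤ 0 := by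
  obtain ⟨η, hη, hη1⟩ := exists_isTestFunction_eq_one hK hO (hKO.trans sdiff_subset)
  set S := tsupport η
  have hS : IsCompact S := hη.hasCompactSupport
  obtain ⟨C, hC⟩ : ∃ C, ∀ x, η x ^ 2 + 2 * ‖gradient η x‖ ^ 2 ≤ C := by
    obtain ⟨C, hC⟩ := (HasCompactSupport.intro (f := fun x => η x ^ 2 + 2 * ‖gradient η x‖ ^ 2) hS
      fun x hx => by
        simp [image_eq_zero_of_notMem_tsupport hx, Function.notMem_support.1 fun h =>
          hx (IsTestFunction.support_gradient_subset η h)]).exists_bound_of_continuous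
      ((hη.continuous.pow 2).add (continuous_const.mul (hη.continuous_gradient.norm.pow 2)))
    exact ⟨C, fun x => (le_abs_self _).trans (hC x)⟩
  have hφ (k) : IsTestFunction univ fun x => η x * (1 - h k x) :=
    (hη.mono (subset_univ _)).of_eq_zero
      (hη.contDiff.mul (contDiff_const.sub (hh k).contDiff)) fun x hx => by simp [hx]
  have hgi (k) : Integrable fun x => ‖η x • gradient (h k) x‖ ^ 2 :=
    ((hη.continuous.smul (hh k).continuous_gradient).memLp_of_hasCompactSupport
      (p := 2) hη.hasCompactSupport.smul_right).integrable_norm_pow (by simp)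
  have hhi (k) : IntegrableOn (fun x => (h k x - 1) ^ 2) S :=
    (((hh k).continuous.sub continuous_const).pow 2).continuousOn.integrableOn_compact hS
  have hle (k) : sobolevCapacity K ≤
      C * (∫ x in S, (h k x - 1) ^ 2) + 2 * ∫ x, ‖η x • gradient (h k) x‖ ^ 2 := by
    refine (sobolevCapacity_le (hφ k) fun x hx => ?_).trans ?_
    · simp [hη1 x hx, (hh k).eq_zero (hKO hx).2]
    rw [← integral_indicator hS.measurableSet, ← integral_const_mul, ← integral_const_mul,
      ← integral_add (((hhi k).integrable_indicator hS.measurableSet).const_mul C)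
        ((hgi k).const_mul 2)]
    refine integral_mono ((hφ k).integrable_sq.add (hφ k).integrable_norm_gradient_sq)
      ((((hhi k).integrable_indicator hS.measurableSet).const_mul C).add
        ((hgi k).const_mul 2)) fun x => ?_
    have hg : gradient (fun x => η x * (1 - h k x)) x =
        -(η x • gradient (h k) x) + (1 - h k x) • gradient η x := by
      have h1 := ((hasDerivAt_id (h k x)).const_sub 1).comp_hasGradientAt ((hh k).hasGradientAt x)
      have h2 := ((hη.hasGradientAt x).fun_mul h1).gradient
      simp only [id, neg_smul, one_smul, smul_neg] at h2
      exact h2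
    have hn : ‖gradient (fun x => η x * (1 - h k x)) x‖ ^ 2 ≤
        2 * ‖η x • gradient (h k) x‖ ^ 2 + 2 * ((1 - h k x) ^ 2 * ‖gradient η x‖ ^ 2) := by
      have h1 := norm_add_le (-(η x • gradient (h k) x)) ((1 - h k x) • gradient η x)
      rw [← hg, norm_neg] at h1
      have h2 : ‖(1 - h k x) • gradient η x‖ ^ 2 = (1 - h k x) ^ 2 * ‖gradient η x‖ ^ 2 := by
        rw [norm_smul, mul_pow, Real.norm_eq_abs, sq_abs]
      rw [← h2]
      have h3 := pow_le_pow_left₀ (norm_nonneg _) h1 2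
      nlinarith [sq_nonneg (‖η x • gradient (h k) x‖ - ‖(1 - h k x) • gradient η x‖)]
    change (η x * (1 - h k x)) ^ 2 + ‖gradient (fun x => η x * (1 - h k x)) x‖ ^ 2 ≤
      C * S.indicator (fun x => (h k x - 1) ^ 2) x + 2 * ‖η x • gradient (h k) x‖ ^ 2
    by_cases hx : x ∈ S
    · rw [indicator_of_mem hx]
      have h1 := mul_le_mul_of_nonneg_right (hC x) (sq_nonneg (h k x - 1))
      nlinarith
    · have h1 : η x = 0 := image_eq_zero_of_notMem_tsupport hx
      have h2 : gradient η x = 0 := Function.notMem_support.1 fun h =>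
        hx (IsTestFunction.support_gradient_subset η h)
      rw [hg]
      simp [hx, h1, h2]
  have h0 := ge_of_tendsto'
    (((hlim S hη.tsupport_subset hS).const_mul C).add ((hgrad η hη).const_mul 2)) hle
  simpa using h0

end Limit

/-! ### Comparison of the spectral bottoms -/

lemma exists_mem_H10_fst_ne_zero {n : ℕ} {O : Set (EuclideanSpace ℝ (Fin n))} (hO : IsOpen O)
    (hne : O.Nonempty) : ∃ v ∈ H10 O, v.fst ≠ 0 := by
  obtain ⟨x, hx⟩ := hne
  obtain ⟨φ, hφ, hφ1⟩ := exists_isTestFunction_eq_one (isCompact_singleton (x := x)) hO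
    (singleton_subset_iff.2 hx)
  obtain ⟨v, hv, h1, -⟩ := hφ.exists_mem_H10
  refine ⟨v, hv, fun h0 => ?_⟩
  have e := hφ.norm_sq_fst h1
  rw [h0, norm_zero, zero_pow two_ne_zero] at e
  have h2 := (integral_eq_zero_iff_of_nonneg (fun x => sq_nonneg (φ x)) hφ.integrable_sq).1 e.symm
  have h3 := congrFun ((Continuous.ae_eq_iff_eq volume (hφ.continuous.pow 2)
    continuous_zero).1 h2) x
  simp [hφ1 x rfl] at h3

/-- A function that does not vanish almost everywhere on `ℝ^d` does not do so as a function on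
`ℝ^(d+1)` either. -/
lemma crossProj_ae_ne_zero {d : ℕ} {u : EuclideanSpace ℝ (Fin d) → ℝ} (hum : Measurable u)
    (hu : MemLp u 2) (hu0 : ¬ u =ᵐ[volume] 0) :
    ¬ ∀ᵐ x : EuclideanSpace ℝ (Fin (d + 1)), u (crossProj x) = 0 := by
  intro h
  have e := integral_crossProj_mul (hum.pow_const 2)
    (measurable_one.indicator (measurableSet_Icc (a := (0 : ℝ)) (b := 1)))
  rw [integral_indicator_one measurableSet_Icc, integral_eq_zero_of_ae (by
    filter_upwards [h] with x hx
    simp [hx])] at e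
  simp only [Real.volume_real_Icc, sub_zero, zero_le_one, sup_of_le_left, mul_one] at e
  have h2 := (integral_eq_zero_iff_of_nonneg (fun x => sq_nonneg (u x)) hu.integrable_sq).1 e.symm
  refine hu0 (h2.mono fun x hx => ?_)
  simpa using hx

open Filter Topology in
/-- If a minimizer of the cross-section exists and the shifted energy is non-negative on
`C_c^∞(O)`, then `O` exceeds the cylinder by a set of capacity zero only. -/
theorem sobolevCapacity_nonpos_of_shiftedEnergy_nonneg {d : ℕ}
    {Q : Set (EuclideanSpace ℝ (Fin d))} {O : Set (EuclideanSpace ℝ (Fin (d + 1)))}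
    (hQ : IsOpen Q) (hO : IsOpen O) (hOc : IsPreconnected O) (hQO : cylinderOver Q ⊆ O)
    {w : WithLp 2 (L2 Q × L2Field Q)} (hw : w ∈ H10 Q) (hw0 : w.fst ≠ 0) {c : ℝ} (hc : 0 ≤ c)
    (hmin : ‖w.snd‖ ^ 2 ≤ c * ‖w.fst‖ ^ 2)
    (hpos : ∀ φ, IsTestFunction O φ → 0 ≤ shiftedEnergy c φ)
    {K : Set (EuclideanSpace ℝ (Fin (d + 1)))} (hK : IsCompact K)
    (hKO : K ⊆ O \ cylinderOver Q) : sobolevCapacity K ≤ 0 := by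
  obtain ⟨u, hum, hu0, huQ, hu, hune, happ⟩ := exists_nonneg_minimizer hQ hw hw0 hc hmin
  obtain ⟨h, hh, hgrad, hlim⟩ := exists_log_sequence hQO hc hpos hum hu0 hu happ
  set Z : EuclideanSpace ℝ (Fin (d + 1)) → ℝ := fun x => if u (crossProj x) = 0 then 0 else 1
    with hZ
  have hZm : Measurable Z :=
    Measurable.ite ((hum.comp crossProj.continuous.measurable) (measurableSet_singleton 0))
      measurable_const measurable_const
  have hZb (x) : ‖Z x‖ ≤ 1 := by simp only [hZ]; split_ifs <;> simp
  have hZL (S) (hS : IsCompact S) : MemLp Z 2 (volume.restrict S) := by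
    have : IsFiniteMeasure (volume.restrict S) := ⟨by
      rw [Measure.restrict_apply_univ]; exact hS.measure_lt_top⟩
    exact MemLp.of_bound hZm.aestronglyMeasurable 1 (.of_forall hZb)
  have hZi : LocallyIntegrable Z :=
    (locallyIntegrable_const (1 : ℝ)).mono hZm.aestronglyMeasurable
      (.of_forall fun x => by simpa using hZb x)
  obtain ⟨b, hb⟩ := ae_eq_const_of_isPreconnected hO hOc hZi fun ψ hψ v =>
    integral_fderiv_mul_limit_eq_zero hh hZL hgrad hlim hψ v
  -- `Z` vanishes outside the cylinder but not almost everywhere, so its constant value on `O` is 1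
  have hZ1 : ∀ᵐ x, x ∈ O → Z x = 1 := by
    by_cases hb0 : b = 0
    · refine absurd ?_ (crossProj_ae_ne_zero hum hu hune)
      filter_upwards [hb] with x hx
      by_cases hxQ : x ∈ cylinderOver Q
      · by_contra hux
        have := hx (hQO hxQ)
        simp [hZ, hux, hb0] at this
      · exact huQ _ hxQ
    · filter_upwards [hb] with x hx hxO
      by_cases hux : u (crossProj x) = 0
      · exact absurd ((hx hxO).symm.trans (if_pos hux)) hb0
      · exact if_neg hux
  refine sobolevCapacity_nonpos hO hh hgrad (fun S hSO hS => ?_) hK hKO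
  refine (hlim S hS).congr fun k => setIntegral_congr_ae hS.measurableSet ?_
  filter_upwards [hZ1] with x hx hxS
  change (h k x - Z x) ^ 2 = _
  rw [hx (hSO hxS)]

theorem theorem4p4 {d : ℕ} (Q : Set (EuclideanSpace ℝ (Fin d)))
    (O : Set (EuclideanSpace ℝ (Fin (d + 1)))) (R : ℝ)
    (hQ : IsOpen Q) (hO : IsOpen O) (hOconn : IsConnected O)
    (hsub : cylinderOver Q ⊂ O)
    (hcap : ∃ K ⊆ O \ cylinderOver Q, IsCompact K ∧ 0 < sobolevCapacity K)
    (hout : O ∩ {x | R < |x (Fin.last d)|} = cylinderOver Q ∩ {x | R < |x (Fin.last d)|})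
    (hbound : ∃ U : L2 Q, IsBoundState Q U) :
    IsGLB (dirichletSpectrum Q) (spectralBottom Q) ∧
    IsGLB (dirichletSpectrum O) (spectralBottom O) ∧
    spectralBottom O < spectralBottom Q := by
  obtain ⟨U, hU0, w, hw, rfl, hwU⟩ := hbound
  have hneQ : ∃ v ∈ H10 Q, v.fst ≠ 0 := ⟨w, hw, hU0⟩
  have hneO := exists_mem_H10_fst_ne_zero hO hOconn.nonempty
  refine ⟨isGLB_spectralBottom hneQ, isGLB_spectralBottom hneO, ?_⟩
  have hmin := hwU w hw
  rw [real_inner_smul_left, real_inner_self_eq_norm_sq, real_inner_self_eq_norm_sq,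
    spectralBottom_eq hneQ] at hmin
  rw [spectralBottom_eq hneQ, spectralBottom_eq hneO]
  by_contra! hle
  obtain ⟨K, hKO, hK, hKpos⟩ := hcap
  exact hKpos.not_ge (sobolevCapacity_nonpos_of_shiftedEnergy_nonneg hQ hO
    hOconn.isPreconnected hsub.subset hw hU0 (rayleighBottom_nonneg Q) hmin.le
    (fun φ hφ => hφ.shiftedEnergy_nonneg hle) hK hKO)
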